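/- Consider $n$ qubits with Hilbert space $(\mathbb C^2)^{\otimes n}$ and the symmetry $\mathrm U(1)$ represented by $u(\theta)^{\otimes n}$ with $u(\theta)=e^{\mathrm i\theta Z}$, where $Z=\mathrm{diag}(1,-1)$. Let $\mathcal V_{n,n}$ be the group of all unitaries that commute with every $u(\theta)^{\otimes n}$, and let $\mathcal V_{n,k}$ be the subgroup generated by those of its elements that act non-trivially on at most $k$ qubits. For a compact group of unitaries, the uniform distribution is its Haar probability measure. The uniform distribution over $\mathcal V_{n,k}$ is a $t$-design (for the uniform distribution over $\mathcal V_{n,n}$) if $$\mathbb E_{V\in\mathcal V_{n,k}}\big[V^{\otimes t}\otimes (V^{*})^{\otimes t}\big]=\mathbb E_{V\in\mathcal V_{n,n}}\big[V^{\otimes t}\otimes (V^{*})^{\otimes t}\big],$$ where $V^*$ is the entrywise complex conjugate, and $t_{\max}(n,k)$ is the largest $t$ for which this holds ($\infty$ if it holds for all $t$). For $0\le k\le n$ put $$F_k=\sum_{w=0}^n(-1)^w\binom{n-\lfloor\frac{k+1}2\rfloor-w}{n-k}\,\Pi_w ,$$ where $\Pi_w$ is the orthogonal projector onto the span of the computational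 basis states of Hamming weight $w$. Here $\binom{a}{j}=a(a-1)\cdots(a-j+1)/j!$ for real $a$ and integer $j\ge0$, and $\|A\|_1=\operatorname{Tr}\sqrt{AA^\dagger}$ is the trace norm. Then for all integers $k\ge 2$ and $n\ge 2^{\lfloor k/2\rfloor}\lfloor\frac{k+3}{2}\rfloor$, the number $t_{\max}(n,k)$ is finite and $$t_{\max}(n,k)+1=\tfrac12\|F_{k+1}\|_1=\begin{cases}2^k\binom{(n-1)/2}{k/2}, & k\text{ even},\\[2pt] 2^k\binom{n/2}{(k+1)/2}, & k\text{ odd}.\end{cases}$$ In particular, $t_{\max}(n,2)=2n-3$ for all $n\ge4$. -/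

import Mathlib

/-! Random `k`-qubit circuits with U(1) symmetry on `n` qubits.

The Hilbert space of `n` qubits has the computational basis `Fin n → Fin 2`, and operators on it are
complex matrices indexed by this basis. -/

namespace U1Circuits

open scoped Matrix
open MeasureTheory

/-- Operators on `n` qubits. -/
abbrev QubitOp (n : ℕ) : Type := Matrix (Fin n → Fin 2) (Fin n → Fin 2) ℂ

/-- The group of unitary operators on `n` qubits. -/
abbrev QubitUnitary (n : ℕ) : Type := Matrix.unitaryGroup (Fin n → Fin 2) ℂ

/-- The unitary group carries its Borel σ-algebra. -/
noncomputable instance instMeasurableSpaceQubitUnitary (n : ℕ) : MeasurableSpace (QubitUnitary n) :=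
  borel (QubitUnitary n)

instance instBorelSpaceQubitUnitary (n : ℕ) : BorelSpace (QubitUnitary n) := ⟨rfl⟩

/-- The tensor power `A^{⊗ t}` of a square matrix. -/
def tensorPow {m : Type*} (t : ℕ) (A : Matrix m m ℂ) : Matrix (Fin t → m) (Fin t → m) ℂ :=
  Matrix.of fun x y => ∏ i, A (x i) (y i)

/-! ### The symmetry and the groups of circuits -/

/-- The representation `u(θ) = exp(i θ Z)` of U(1) on one qubit. -/
noncomputable def chargeRep (θ : ℝ) : Matrix (Fin 2) (Fin 2) ℂ :=
  Matrix.diagonal ![Complex.exp (Complex.I * θ), Complex.exp (-(Complex.I * θ))]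

/-- `V` is U(1)-invariant: it commutes with `u(θ)^{⊗ n}` for all `θ`. -/
def IsSymmetric {n : ℕ} (V : QubitOp n) : Prop :=
  ∀ θ : ℝ, V * tensorPow n (chargeRep θ) = tensorPow n (chargeRep θ) * V

/-- `V` is `k`-local: for some set `S` of at most `k` qubits, `V` is an operator `A` on the qubits
in `S` tensored with the identity on the remaining ones. The qubits in `S` need not be adjacent. -/
def IsLocal {n : ℕ} (k : ℕ) (V : QubitOp n) : Prop :=
  ∃ S : Finset (Fin n), S.card ≤ k ∧ ∃ A : Matrix (S → Fin 2) (S → Fin 2) ℂ,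
    ∀ x y : Fin n → Fin 2,
      V x y = if ∀ i, i ∉ S → x i = y i then A (fun i => x i) (fun i => y i) else 0

/-- The group of all U(1)-invariant unitaries on `n` qubits. -/
def symmetricGroup (n : ℕ) : Subgroup (QubitUnitary n) where
  carrier := {V | IsSymmetric (V : QubitOp n)}
  one_mem' := fun θ => by simp
  mul_mem' := by
    intro V W hV hW θ
    have h1 := hV θ
    have h2 := hW θ
    simp only [Submonoid.coe_mul] at *
    rw [Matrix.mul_assoc, h2, ← Matrix.mul_assoc, h1, Matrix.mul_assoc]
  inv_mem' := by
    intro V hV θ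
    have h1 := hV θ
    have h2 : ((V⁻¹ : QubitUnitary n) : QubitOp n) * (V : QubitOp n) = 1 := by
      rw [← Submonoid.coe_mul, inv_mul_cancel, Submonoid.coe_one]
    have h3 : (V : QubitOp n) * ((V⁻¹ : QubitUnitary n) : QubitOp n) = 1 := by
      rw [← Submonoid.coe_mul, mul_inv_cancel, Submonoid.coe_one]
    calc ((V⁻¹ : QubitUnitary n) : QubitOp n) * tensorPow n (chargeRep θ)
        = (V⁻¹ : QubitUnitary n) * tensorPow n (chargeRep θ) *
            ((V : QubitOp n) * ((V⁻¹ : QubitUnitary n) : QubitOp n)) := by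
          rw [h3, Matrix.mul_one]
      _ = (V⁻¹ : QubitUnitary n) * ((V : QubitOp n) * tensorPow n (chargeRep θ)) *
            ((V⁻¹ : QubitUnitary n) : QubitOp n) := by
          rw [h1]; simp only [Matrix.mul_assoc]
      _ = tensorPow n (chargeRep θ) * ((V⁻¹ : QubitUnitary n) : QubitOp n) := by
          rw [← Matrix.mul_assoc, h2, Matrix.one_mul]

/-- The group generated by the `k`-local U(1)-invariant unitaries on `n` qubits. -/
def circuitGroup (n k : ℕ) : Subgroup (QubitUnitary n) :=
  Subgroup.closure {V | IsSymmetric (V : QubitOp n) ∧ IsLocal k (V : QubitOp n)}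

/-! ### Uniform distributions and designs -/

open Classical in
/-- The uniform distribution over a compact group `W` of unitaries: the Haar probability measure of
`W`, seen as a measure on the full unitary group. For a group that is not compact the value is the
zero measure, which is not a `t`-design for any probability measure and any `t`, `t = 0` included. -/
noncomputable def uniformDistribution {n : ℕ} (W : Subgroup (QubitUnitary n)) :
    Measure (QubitUnitary n) :=
  if _h : CompactSpace W then
    (Measure.haarMeasure (⊤ : TopologicalSpace.PositiveCompacts W)).map Subtype.val
  else 0

/-- The matrix `V^{⊗ t} ⊗ (V^*)^{⊗ t}`, where `V^*` is the entrywise complex conjugate. -/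
noncomputable def momentMatrix {n : ℕ} (t : ℕ) (V : QubitUnitary n) :
    Matrix ((Fin t → Fin n → Fin 2) × (Fin t → Fin n → Fin 2))
      ((Fin t → Fin n → Fin 2) × (Fin t → Fin n → Fin 2)) ℂ :=
  Matrix.kronecker (tensorPow t (V : QubitOp n)) (tensorPow t ((V : QubitOp n).map star))

/-- `ν` is a `t`-design for `μ`: the expectations of `V^{⊗ t} ⊗ (V^*)^{⊗ t}` under `ν` and `μ`
are equal. -/
def IsDesign {n : ℕ} (t : ℕ) (ν μ : Measure (QubitUnitary n)) : Prop :=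
  ∀ a b, ∫ V, momentMatrix t V a b ∂ν = ∫ V, momentMatrix t V a b ∂μ

/-- The largest `t` such that the uniform distribution over the group generated by the `k`-qubit
U(1)-invariant gates is a `t`-design for the uniform distribution over the group of all
U(1)-invariant unitaries, and `⊤` if it is a `t`-design for arbitrarily large `t`. -/
noncomputable def tMax (n k : ℕ) : ℕ∞ :=
  ⨆ (t : ℕ) (_ : IsDesign t (uniformDistribution (circuitGroup n k))
    (uniformDistribution (symmetricGroup n))), (t : ℕ∞)

/-! ### The operators `F_k` -/

/-- The projector `Π_w` to the sector of Hamming weight `w`. -/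
def weightProjector (n w : ℕ) : QubitOp n :=
  Matrix.diagonal fun x => if hammingNorm x = w then 1 else 0

/-- The eigenvalue `f_k(w) = (-1)^w * binom(n - ⌊(k+1)/2⌋ - w, n - k)` for `k ≤ n`. The binomial
coefficient is the generalized one, `binom(a, j) = a (a-1) ⋯ (a-j+1) / j!`, with an integer `a` that
may be negative. -/
def fEigenvalue (n k w : ℕ) : ℤ :=
  (-1) ^ w * Ring.choose ((n : ℤ) - (((k + 1) / 2 : ℕ) : ℤ) - (w : ℤ)) (n - k)

/-- The operator `F_k = ∑_w f_k(w) Π_w` on `n` qubits, for `k ≤ n`. -/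
noncomputable def opF (n k : ℕ) : QubitOp n :=
  ∑ w ∈ Finset.range (n + 1), (fEigenvalue n k w : ℂ) • weightProjector n w

open scoped MatrixOrder ComplexOrder in
/-- The trace norm `‖A‖₁ = Tr √(A A†)`. -/
noncomputable def traceNorm {n : ℕ} (A : QubitOp n) : ℝ :=
  (CFC.sqrt (A * Aᴴ)).trace.re

end U1Circuits

/-!
Write `d_w(V)` for the determinant of the block of a symmetric unitary `V` on the sector of Hamming
weight `w`, which has dimension `binom(n, w)`. For `k ≥ 2` the group generated by the `k`-local
symmetric unitaries is the set of symmetric unitaries on which certain monomials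
`∏ w, d_w(V) ^ x_w` equal `1` (`mem_circuitGroup_iff`). The admissible exponents form the lattice of
integer vectors `x` with `∑ i, binom(n - k, i) * x (j + i) = 0` for `0 ≤ j ≤ k` (`IsDetRelation`):
these equations hold because a block of weight `j` on `k` qubits is repeated `binom(n - k, i)` times
in the sector of weight `j + i`. Conversely, commutators of two-qubit gates with sign flips give all
controlled rotations, hence all rotations in the plane of two basis states of equal weight, and by
Givens reduction every symmetric unitary with `d_w = 1` for all `w`
(`mem_circuitGroup_of_sectorDet_eq_one`); the determinants themselves are reached by diagonal
`k`-qubit phases, because the lattice equations are unitriangular.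

A monomial with exponents `x` is a polynomial of degree `½ ∑ w, binom(n, w) * |x_w|` in the entries
of `V` and of the same degree in those of `V^*`. If `x ≠ 0` is in the lattice, its average is `1`
over the circuits and `0` over all symmetric unitaries, so the circuits are not a `t`-design for `t`
from this degree on (`not_isDesign_of_detCost_le`). If every nonzero `x` has a degree greater than
`t`, then a vector fixed by `V^{⊗ t} ⊗ (V^*)^{⊗ t}` for all circuits has no component on which the
sector phases act nontrivially: the excess of the weight `w` among the tensor factors would be
`binom(n, w) * x_w` with `x` in the lattice, at too low a degree. The vector is then fixed by all
symmetric unitaries, and the circuits are a `t`-design (`isDesign_of_lt_detCost`).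

It remains to find the cheapest nonzero `x`, which is the vector of eigenvalues of `F_{k+1}`. These
form a lattice vector because finite differences of order `n - k` kill polynomials of degree
`n - k - 1`. The entries of any lattice vector, weighted by `binom(n, w)`, sum to zero, so a cheaper
vector vanishes on every sector of dimension at least the degree claimed; the bound on `n` makes
these all the sectors in the middle, and the lattice equations leave one free parameter for even `k`
and two for odd `k` (`detCost_fEigenvalue_le_even`, `detCost_fEigenvalue_le_odd`). The single case
`n = 6`, `k = 3` is a finite check. The trace norm of `F_{k+1}` is the cost of its eigenvalues, whose
closed form follows from a recurrence for the coefficients of `(1 + X) ^ n / (1 - X) ^ (n - 2 p)`.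
-/

namespace U1Circuits

open Finset MeasureTheory
open scoped Matrix ComplexConjugate

/-! ### Integer relations among the sector determinants -/

/-- `x` is orthogonal to the vectors `w ↦ binom(n - k, w - j)` for `0 ≤ j ≤ k`. Since
`binom(n - k, w - j)` is the exponent with which the phase of a basis state of weight `j` on `k`
qubits enters the determinant of the sector of weight `w`, these `x` are the exponents of the
monomials in the sector determinants that are trivial on `k`-local symmetric unitaries. Only the
values `x w` with `w ≤ n` matter. -/
def IsDetRelation (n k : ℕ) (x : ℕ → ℤ) : Prop :=
  ∀ j ≤ k, ∑ i ∈ range (n - k + 1), ((n - k).choose i : ℤ) * x (j + i) = 0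

/-- The `ℓ¹`-norm of `x` weighted by the dimensions of the sectors. Its half is the number of copies
of `V`, and of `V^*`, in the monomial in the sector determinants with exponents `x`. -/
def detCost (n : ℕ) (x : ℕ → ℤ) : ℤ := ∑ w ∈ range (n + 1), (n.choose w : ℤ) * |x w|

theorem sum_choose_succ_eq_add_shift {R : Type*} [CommRing R] (M : ℕ) (g : ℕ → R) :
    ∑ i ∈ range (M + 2), ((M + 1).choose i : R) * g i =
      ∑ i ∈ range (M + 1), (M.choose i : R) * g i +
        ∑ i ∈ range (M + 1), (M.choose i : R) * g (i + 1) := by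
  rw [sum_choose_succ_mul (fun i _ => g i), add_comm]

theorem IsDetRelation.of_succ {n k : ℕ} {x : ℕ → ℤ} (hk : k + 1 ≤ n)
    (hx : IsDetRelation n (k + 1) x) : IsDetRelation n k x := by
  intro j hj
  obtain ⟨M, rfl⟩ : ∃ M, n = M + (k + 1) := ⟨n - (k + 1), by omega⟩
  have h1 := hx j (by omega)
  have h2 := hx (j + 1) (by omega)
  rw [show M + (k + 1) - (k + 1) = M by omega] at h1 h2
  rw [show M + (k + 1) - k = M + 1 by omega, sum_choose_succ_eq_add_shift M (fun i => x (j + i)),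
    h1, zero_add, ← h2]
  exact sum_congr rfl fun i _ => by rw [show j + (i + 1) = j + 1 + i by omega]

theorem IsDetRelation.mono {n k s : ℕ} {x : ℕ → ℤ} (hk : k ≤ n) (hs : s ≤ k)
    (hx : IsDetRelation n k x) : IsDetRelation n s x := by
  induction k, hs using Nat.le_induction with
  | base => exact hx
  | succ k hsk ih => exact ih (by omega) (hx.of_succ hk)

theorem IsDetRelation.sum_eq_zero {n k : ℕ} {x : ℕ → ℤ} (hk : k ≤ n) (hx : IsDetRelation n k x) :
    ∑ w ∈ range (n + 1), (n.choose w : ℤ) * x w = 0 := by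
  simpa using hx.mono hk (Nat.zero_le k) 0 le_rfl

theorem IsDetRelation.linearComb {n k : ℕ} {x y : ℕ → ℤ} (hx : IsDetRelation n k x)
    (hy : IsDetRelation n k y) (a b : ℤ) : IsDetRelation n k (fun w => a * x w + b * y w) := by
  intro j hj
  have : ∀ i, ((n - k).choose i : ℤ) * (a * x (j + i) + b * y (j + i)) =
      a * (((n - k).choose i : ℤ) * x (j + i)) + b * (((n - k).choose i : ℤ) * y (j + i)) :=
    fun i => by ring
  simp only [this, sum_add_distrib, ← mul_sum, hx j hj, hy j hj, mul_zero, add_zero]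

theorem IsDetRelation.reflect {n k : ℕ} {x : ℕ → ℤ} (hk : k ≤ n) (hx : IsDetRelation n k x) :
    IsDetRelation n k (fun w => x (n - w)) := by
  intro j hj
  rw [← hx (k - j) (by omega), ← sum_range_reflect]
  refine sum_congr rfl fun i hi => ?_
  have hi' := mem_range.1 hi
  rw [show n - k + 1 - 1 - i = n - k - i by omega, Nat.choose_symm (by omega),
    show k - j + i = n - (j + (n - k - i)) by omega]

theorem IsDetRelation.eq_zero_of_ge {n k a : ℕ} {x : ℕ → ℤ} (hk : k ≤ n)
    (hx : IsDetRelation n k x) (h0 : ∀ w, a ≤ w → w < a + (n - k) → x w = 0) :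
    ∀ w, a ≤ w → w ≤ n → x w = 0 := by
  intro w
  induction w using Nat.strong_induction_on with
  | _ w ih =>
    intro haw hwn
    by_cases hlt : w < a + (n - k)
    · exact h0 w haw hlt
    have h := hx (w - (n - k)) (by omega)
    rw [sum_range_succ, Finset.sum_eq_zero, zero_add, Nat.choose_self, Nat.cast_one, one_mul,
      Nat.sub_add_cancel (by omega)] at h
    · exact h
    · intro i hi
      have := mem_range.1 hi
      rw [ih (w - (n - k) + i) (by omega) (by omega) (by omega), mul_zero]

/-- A relation is determined by its values on `n - k` consecutive weights. -/
theorem IsDetRelation.eq_zero_of_window {n k a : ℕ} {x : ℕ → ℤ} (hk : k ≤ n)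
    (hx : IsDetRelation n k x) (ha : a + (n - k) ≤ n + 1)
    (h0 : ∀ w, a ≤ w → w < a + (n - k) → x w = 0) : ∀ w ≤ n, x w = 0 := by
  intro w hw
  by_cases haw : a ≤ w
  · exact hx.eq_zero_of_ge hk h0 w haw hw
  · have h := (hx.reflect hk).eq_zero_of_ge (a := n + 1 - (a + (n - k))) hk
      (fun v hv1 hv2 => h0 _ (by omega) (by omega)) (n - w) (by omega) (by omega)
    simpa only [Nat.sub_sub_self hw] using h

/-- The `M`-th finite difference of a polynomial of degree `d < M` vanishes. -/
theorem alternating_sum_choose_eq_zero (M d : ℕ) (hd : d < M) (b : ℤ) :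
    ∑ i ∈ range (M + 1), (M.choose i : ℤ) * ((-1) ^ i * Ring.choose (b - i) d) = 0 := by
  induction M generalizing d b with
  | zero => omega
  | succ M ih =>
    rw [sum_choose_succ_eq_add_shift M (fun i => (-1) ^ i * Ring.choose (b - (i : ℤ)) d),
      ← sum_add_distrib]
    cases d with
    | zero =>
      refine sum_eq_zero fun i _ => ?_
      simp [pow_succ]
    | succ d =>
      rw [← ih d (by omega) (b - 1)]
      refine sum_congr rfl fun i _ => ?_
      have h := Ring.choose_succ_succ (b - 1 - (i : ℤ)) d
      rw [show b - 1 - (i : ℤ) + 1 = b - i by ring] at h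
      rw [h, pow_succ]
      push_cast
      rw [show b - ((i : ℤ) + 1) = b - 1 - i by ring]
      ring

theorem isDetRelation_fEigenvalue {n k : ℕ} (hk : k + 1 ≤ n) :
    IsDetRelation n k (fEigenvalue n (k + 1)) := by
  intro j _
  have h := alternating_sum_choose_eq_zero (n - k) (n - (k + 1)) (by omega)
    ((n : ℤ) - (((k + 1 + 1) / 2 : ℕ) : ℤ) - j)
  have h2 : ∀ i : ℕ, ((n - k).choose i : ℤ) * fEigenvalue n (k + 1) (j + i) =
      (-1) ^ j * (((n - k).choose i : ℤ) * ((-1) ^ i *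
        Ring.choose ((n : ℤ) - (((k + 1 + 1) / 2 : ℕ) : ℤ) - j - i) (n - (k + 1)))) := by
    intro i
    rw [fEigenvalue, pow_add]
    push_cast
    rw [sub_add_eq_sub_sub]
    ring
  simp only [h2, ← mul_sum, h, mul_zero]

/-! ### The eigenvalues of `F` -/

/-- Here and below `n = M + 1 + p + r` and `k = p + r`, where `p` and `r` are the two halves of `k`,
rounded up and down: `f` is supported on the weights `w ≤ p` and `w ≥ n - r`. -/
theorem fEigenvalue_low (M p r w : ℕ) (hr : r = p ∨ p = r + 1) (hw : w ≤ p) :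
    fEigenvalue (M + 1 + p + r) (p + r + 1) w = (-1) ^ w * ((M + p - w).choose M : ℤ) := by
  rw [fEigenvalue, show (p + r + 1 + 1) / 2 = r + 1 by omega,
    show M + 1 + p + r - (p + r + 1) = M by omega,
    show ((M + 1 + p + r : ℕ) : ℤ) - ((r + 1 : ℕ) : ℤ) - w = ((M + p - w : ℕ) : ℤ) by omega,
    Ring.choose_natCast]

theorem fEigenvalue_mid (M p r w : ℕ) (hr : r = p ∨ p = r + 1) (hw : p < w) (hw2 : w ≤ M + p) :
    fEigenvalue (M + 1 + p + r) (p + r + 1) w = 0 := by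
  rw [fEigenvalue, show (p + r + 1 + 1) / 2 = r + 1 by omega,
    show M + 1 + p + r - (p + r + 1) = M by omega,
    show ((M + 1 + p + r : ℕ) : ℤ) - ((r + 1 : ℕ) : ℤ) - w = ((M + p - w : ℕ) : ℤ) by omega,
    Ring.choose_natCast, Nat.choose_eq_zero_of_lt (by omega)]
  simp

theorem fEigenvalue_high (M p r v : ℕ) (hr : r = p ∨ p = r + 1) (hv : v ≤ r) :
    fEigenvalue (M + 1 + p + r) (p + r + 1) (M + 1 + p + r - v) =
      (-1) ^ (p + r + 1) * ((-1) ^ v * ((M + r - v).choose M : ℤ)) := by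
  rw [fEigenvalue, show (p + r + 1 + 1) / 2 = r + 1 by omega,
    show M + 1 + p + r - (p + r + 1) = M by omega,
    show ((M + 1 + p + r : ℕ) : ℤ) - ((r + 1 : ℕ) : ℤ) - ((M + 1 + p + r - v : ℕ) : ℤ)
      = -((r - v + 1 : ℕ) : ℤ) by omega, Ring.choose_neg,
    show ((r - v + 1 : ℕ) : ℤ) + (M : ℤ) - 1 = ((M + r - v : ℕ) : ℤ) by omega, Ring.choose_natCast,
    Units.smul_def, Int.negOnePow_def, zpow_natCast]
  have h1 : ((-1 : ℤ)) ^ (M + 1 + p + r - v) * (-1) ^ M = (-1) ^ (p + r + 1) * (-1) ^ v := by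
    rw [← pow_add, ← pow_add]
    apply neg_one_pow_congr
    simp only [Nat.even_iff]
    omega
  push_cast
  rw [smul_eq_mul, ← mul_assoc, h1, mul_assoc]

/-! ### The cost of the eigenvalues in closed form -/

/-- The coefficient of `X ^ p` in `(1 + X) ^ n / (1 - X) ^ (n - 2 p)`. -/
noncomputable def shellCoeff (n p : ℕ) : ℤ :=
  PowerSeries.coeff p ((1 + PowerSeries.X : PowerSeries ℤ) ^ n * PowerSeries.mk 1 ^ (n - 2 * p))

theorem derivative_mk_one_pow (m : ℕ) :
    PowerSeries.derivative ℤ ((PowerSeries.mk 1 : PowerSeries ℤ) ^ m) =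
      (m : PowerSeries ℤ) * PowerSeries.mk 1 ^ (m + 1) := by
  set u : PowerSeries ℤ := PowerSeries.mk 1 with hu
  have h1 : u * (1 - PowerSeries.X) = 1 := PowerSeries.mk_one_mul_one_sub_eq_one ℤ
  have h2 : PowerSeries.derivative ℤ u = u ^ 2 := by
    have h3 := congrArg (PowerSeries.derivative ℤ) h1
    simp only [Derivation.leibniz, map_sub, PowerSeries.derivative_X, Derivation.map_one_eq_zero,
      smul_eq_mul] at h3
    linear_combination u * h3 - PowerSeries.derivative ℤ u * h1
  cases m with
  | zero => simp
  | succ m =>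
    rw [Derivation.leibniz_pow, h2, Nat.add_sub_cancel]
    simp only [smul_eq_mul, nsmul_eq_mul]
    ring

/-- The recurrence behind the closed form. With `u = 1 / (1 - X)`, the difference of the two sides
is the coefficient of `X ^ p` in `-2 (X h' - p h)` for `h = (1 + X) ^ n * u ^ (m + 1)`, which is
zero. -/
theorem shellCoeff_succ (n p : ℕ) (h : 2 * (p + 1) ≤ n) :
    ((p : ℤ) + 1) * shellCoeff n (p + 1) = 2 * ((n : ℤ) - 2 * p - 1) * shellCoeff n p := by
  obtain ⟨m, rfl⟩ : ∃ m, n = m + 2 * (p + 1) := ⟨n - 2 * (p + 1), by omega⟩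
  set N := m + 2 * (p + 1) with hN
  set u : PowerSeries ℤ := PowerSeries.mk 1 with hu
  have h1 : u * (1 - PowerSeries.X) = 1 := PowerSeries.mk_one_mul_one_sub_eq_one ℤ
  set P : PowerSeries ℤ := (1 + PowerSeries.X) ^ (m + 2 * p + 1) with hP
  have hPN : (1 + PowerSeries.X : PowerSeries ℤ) ^ N = (1 + PowerSeries.X) * P := by
    rw [hP, ← pow_succ', hN]
    congr 1
  have hDP : PowerSeries.derivative ℤ ((1 + PowerSeries.X : PowerSeries ℤ) ^ N) =
      (m + 2 * p + 2) * P := by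
    rw [Derivation.leibniz_pow, hN, show m + 2 * (p + 1) - 1 = m + 2 * p + 1 by omega, ← hP]
    simp only [smul_eq_mul, nsmul_eq_mul, map_add, Derivation.map_one_eq_zero,
      PowerSeries.derivative_X]
    push_cast
    ring
  have key : PowerSeries.derivative ℤ ((1 + PowerSeries.X : PowerSeries ℤ) ^ N * u ^ m) +
      2 * (PowerSeries.X * PowerSeries.derivative ℤ
        ((1 + PowerSeries.X : PowerSeries ℤ) ^ N * u ^ (m + 1))) =
      (2 * (m + 1) : PowerSeries ℤ) * ((1 + PowerSeries.X : PowerSeries ℤ) ^ N * u ^ (m + 2)) +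
      (2 * p : PowerSeries ℤ) * ((1 + PowerSeries.X : PowerSeries ℤ) ^ N * u ^ (m + 1)) := by
    simp only [Derivation.leibniz, smul_eq_mul]
    rw [hDP, hu, derivative_mk_one_pow, derivative_mk_one_pow, ← hu, hPN]
    clear_value P u
    push_cast
    linear_combination (-P * u ^ m * ((m + 2 * p + 2) +
      (2 * m + 2) * (1 + PowerSeries.X) * u)) * h1
  have h3 := congrArg (PowerSeries.coeff p) key
  rw [shellCoeff, shellCoeff, show N - 2 * (p + 1) = m by omega, show N - 2 * p = m + 2 by omega]
  have c1 : (2 * (m + 1) : PowerSeries ℤ) = PowerSeries.C (2 * (m + 1) : ℤ) := by simp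
  have c2 : (2 * p : PowerSeries ℤ) = PowerSeries.C (2 * p : ℤ) := by simp
  have c3 : (2 : PowerSeries ℤ) = PowerSeries.C (2 : ℤ) := by simp
  have c4 : PowerSeries.coeff p (PowerSeries.X * PowerSeries.derivative ℤ
      ((1 + PowerSeries.X : PowerSeries ℤ) ^ N * u ^ (m + 1))) =
      p * PowerSeries.coeff p ((1 + PowerSeries.X : PowerSeries ℤ) ^ N * u ^ (m + 1)) := by
    cases p with
    | zero => simp
    | succ p =>
      rw [PowerSeries.coeff_succ_X_mul, PowerSeries.coeff_derivative]
      push_cast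
      ring
  rw [c1, c2, map_add, map_add, PowerSeries.coeff_derivative, PowerSeries.coeff_C_mul,
    PowerSeries.coeff_C_mul] at h3
  rw [c3, PowerSeries.coeff_C_mul, c4] at h3
  rw [hN]
  push_cast
  linear_combination h3

theorem shellCoeff_zero (n : ℕ) : shellCoeff n 0 = 1 := by
  have : PowerSeries.constantCoeff (PowerSeries.mk 1 : PowerSeries ℤ) = 1 := by
    simp [← PowerSeries.coeff_zero_eq_constantCoeff_apply]
  simp [shellCoeff, this]

theorem ring_choose_succ_mul (a : ℝ) (p : ℕ) :
    ((p : ℝ) + 1) * Ring.choose a (p + 1) = (a - p) * Ring.choose a p := by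
  have h := Ring.choose_smul_choose a (Nat.le_add_right p 1)
  rw [Nat.add_sub_cancel_left,
    Ring.choose_one_right, Nat.choose_succ_self_right, nsmul_eq_mul] at h
  push_cast at h
  linear_combination h

theorem shellCoeff_eq_choose (n p : ℕ) (h : 2 * p ≤ n) :
    (shellCoeff n p : ℝ) = 4 ^ p * Ring.choose (((n : ℝ) - 1) / 2) p := by
  induction p with
  | zero => simp [shellCoeff_zero]
  | succ p ih =>
    have h1 : ((p : ℝ) + 1) * shellCoeff n (p + 1) = 2 * ((n : ℝ) - 2 * p - 1) * shellCoeff n p := by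
      exact_mod_cast shellCoeff_succ n p h
    have h2 := ring_choose_succ_mul (((n : ℝ) - 1) / 2) p
    rw [ih (by omega)] at h1
    have h3 : ((p : ℝ) + 1) ≠ 0 := by positivity
    apply mul_left_cancel₀ h3
    rw [h1, pow_succ]
    linear_combination -(4 ^ p * 4) * h2

theorem factorial_mul_shellCoeff (n p : ℕ) (h : 2 * p ≤ n) :
    (p.factorial : ℤ) * shellCoeff n p = 2 ^ p * ∏ i ∈ range p, ((n : ℤ) - 2 * i - 1) := by
  induction p with
  | zero => simp [shellCoeff_zero]
  | succ p ih =>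
    rw [prod_range_succ, Nat.factorial_succ, pow_succ]
    push_cast
    linear_combination (p.factorial : ℤ) * shellCoeff_succ n p h +
      2 * ((n : ℤ) - 2 * p - 1) * ih (by omega)

/-- The sum of `binom(n, w) * |f w|` over one end of the support of `f`. -/
def shellSum (n M p : ℕ) : ℤ :=
  ∑ v ∈ range (p + 1), (n.choose v : ℤ) * ((M + p - v).choose M : ℤ)

theorem shellSum_eq_coeff (n M p : ℕ) :
    shellSum n M p = PowerSeries.coeff p
      ((1 + PowerSeries.X : PowerSeries ℤ) ^ n * PowerSeries.mk 1 ^ (M + 1)) := by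
  rw [PowerSeries.mk_one_pow_eq_mk_choose_add, PowerSeries.coeff_mul,
    Nat.sum_antidiagonal_eq_sum_range_succ_mk, shellSum]
  refine sum_congr rfl fun v hv => ?_
  have := mem_range.1 hv
  have hc : (1 + PowerSeries.X : PowerSeries ℤ) ^ n =
      (((1 + Polynomial.X) ^ n : Polynomial ℤ) : PowerSeries ℤ) := by simp
  rw [PowerSeries.coeff_mk, hc, Polynomial.coeff_coe, Polynomial.coeff_one_add_X_pow]
  simp [show M + (p - v) = M + p - v by omega]

theorem shellSum_eq_shellCoeff (M p : ℕ) :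
    shellSum (M + 1 + p + p) M p = shellCoeff (M + 1 + p + p) p := by
  rw [shellSum_eq_coeff, shellCoeff, show M + 1 + p + p - 2 * p = M + 1 by omega]

theorem shellSum_succ_add_eq_shellCoeff (M r : ℕ) :
    shellSum (M + 1 + (r + 1) + r) M (r + 1) + shellSum (M + 1 + (r + 1) + r) M r =
      shellCoeff (M + 1 + (r + 1) + r + 1) (r + 1) := by
  rw [shellSum_eq_coeff, shellSum_eq_coeff, shellCoeff,
    show M + 1 + (r + 1) + r + 1 - 2 * (r + 1) = M + 1 by omega,
    pow_succ' (1 + PowerSeries.X) (M + 1 + (r + 1) + r), mul_assoc, add_mul,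
    one_mul, map_add, PowerSeries.coeff_succ_X_mul]

theorem sum_range_ends {R : Type*} [AddCommMonoid R] (M p r : ℕ) (h : ℕ → R)
    (h0 : ∀ w, p < w → w ≤ M + p → h w = 0) :
    ∑ w ∈ range (M + 1 + p + r + 1), h w =
      ∑ v ∈ range (p + 1), h v + ∑ v ∈ range (r + 1), h (M + 1 + p + r - v) := by
  rw [show M + 1 + p + r + 1 = (p + 1 + M) + (r + 1) by omega, sum_range_add, sum_range_add]
  congr 1
  · rw [Finset.sum_eq_zero (s := range M), add_zero]
    intro i hi
    have := mem_range.1 hi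
    exact h0 _ (by omega) (by omega)
  · rw [← sum_range_reflect]
    refine sum_congr rfl fun v hv => ?_
    have := mem_range.1 hv
    congr 1
    omega

theorem detCost_fEigenvalue (M p r : ℕ) (hr : r = p ∨ p = r + 1) :
    detCost (M + 1 + p + r) (fEigenvalue (M + 1 + p + r) (p + r + 1)) =
      shellSum (M + 1 + p + r) M p + shellSum (M + 1 + p + r) M r := by
  rw [detCost, sum_range_ends M p r]
  · congr 1
    · refine sum_congr rfl fun v hv => ?_
      rw [fEigenvalue_low M p r v hr (by have := mem_range.1 hv; omega), abs_mul, abs_pow, abs_neg,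
        abs_one, one_pow, one_mul, Nat.abs_cast]
    · refine sum_congr rfl fun v hv => ?_
      have := mem_range.1 hv
      rw [fEigenvalue_high M p r v hr (by omega), abs_mul, abs_mul, abs_pow, abs_pow, abs_neg,
        abs_one, one_pow, one_pow, one_mul, one_mul, Nat.abs_cast, Nat.choose_symm (by omega)]
  · intro w h1 h2
    rw [fEigenvalue_mid M p r w hr h1 h2, abs_zero, mul_zero]

/-! ### Minimality of the cost of the eigenvalues -/

/-- The entries of a relation, weighted by the sector dimensions, sum to zero, so one entry
accounts for at most half of the cost. -/
theorem IsDetRelation.two_mul_choose_mul_abs_le {n k : ℕ} {x : ℕ → ℤ} (hk : k ≤ n)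
    (hx : IsDetRelation n k x) {w : ℕ} (hw : w ≤ n) :
    2 * ((n.choose w : ℤ) * |x w|) ≤ detCost n x := by
  have hmem : w ∈ range (n + 1) := mem_range.2 (by omega)
  have h0 := hx.sum_eq_zero hk
  rw [← add_sum_erase _ _ hmem] at h0
  rw [detCost, ← add_sum_erase _ _ hmem]
  have h1 := congrArg abs (eq_neg_of_add_eq_zero_left h0)
  rw [abs_neg, abs_mul, Nat.abs_cast] at h1
  have h2 : |∑ v ∈ (range (n + 1)).erase w, (n.choose v : ℤ) * x v| ≤
      ∑ v ∈ (range (n + 1)).erase w, (n.choose v : ℤ) * |x v| := by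
    refine (abs_sum_le_sum_abs _ _).trans (le_of_eq ?_)
    simp only [abs_mul, Nat.abs_cast]
  linarith

theorem choose_le_choose_of_mem_window {n s w : ℕ} (h1 : s ≤ w) (h2 : w + s ≤ n) :
    n.choose s ≤ n.choose w := by
  have key : ∀ t, s ≤ t → t ≤ n / 2 → n.choose s ≤ n.choose t := by
    intro t ht
    induction t, ht using Nat.le_induction with
    | base => exact fun _ => le_rfl
    | succ t _ ih =>
      exact fun h => (ih (by omega)).trans (Nat.choose_le_succ_of_lt_half_left (by omega))
  by_cases hw : w ≤ n / 2
  · exact key w h1 hw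
  · rw [← Nat.choose_symm (show w ≤ n by omega)]
    exact key (n - w) (by omega) (by omega)

theorem factorial_mul_choose_eq_prod {n p : ℕ} (h : p + 1 ≤ n) :
    ((p + 1).factorial : ℤ) * (n.choose (p + 1) : ℤ) =
      n * ∏ i ∈ range p, ((n : ℤ) - i - 1) := by
  rw [← Nat.cast_mul, ← Nat.descFactorial_eq_factorial_mul_choose,
    Nat.descFactorial_eq_prod_range, prod_range_succ', mul_comm]
  push_cast
  rw [Nat.sub_zero]
  congr 1
  refine prod_congr rfl fun i hi => ?_
  have := mem_range.1 hi
  rw [Nat.cast_sub (by omega)]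
  push_cast
  ring

/-- The bound `2 ^ p * (p + 1) ≤ n` supplies the first factor `n` of `binom(n, p + 1)`; the other
factors are compared one by one. -/
theorem shellCoeff_le_choose {n p : ℕ} (hn : 2 ^ p * (p + 1) ≤ n) (h2 : 2 * p + 1 ≤ n) :
    shellCoeff n p ≤ n.choose (p + 1) := by
  have hf : (0 : ℤ) < (p + 1).factorial := by exact_mod_cast Nat.factorial_pos _
  refine le_of_mul_le_mul_left ?_ hf
  rw [factorial_mul_choose_eq_prod (by omega), Nat.factorial_succ]
  push_cast
  rw [mul_assoc, factorial_mul_shellCoeff n p (by omega), ← mul_assoc]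
  have hn' : ((p : ℤ) + 1) * 2 ^ p ≤ n := by
    rw [mul_comm]
    exact_mod_cast hn
  have hnn : ∀ i ∈ range p, (0 : ℤ) ≤ (n : ℤ) - 2 * i - 1 := by
    intro i hi
    have := mem_range.1 hi
    omega
  refine mul_le_mul hn' (prod_le_prod hnn fun i hi => ?_) (prod_nonneg hnn) (by positivity)
  omega

/-- The two factors for `i = 0` compare the wrong way; the product of the first three settles it. -/
theorem prod_sub_two_mul_le {n j : ℕ} (hj : 3 ≤ j) (hn : 2 * j ≤ n) :
    ∏ i ∈ range j, ((n : ℤ) - 2 * i) ≤ ∏ i ∈ range j, ((n : ℤ) - i - 1) := by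
  induction j, hj using Nat.le_induction with
  | base =>
    simp only [prod_range_succ, prod_range_zero]
    have : (6 : ℤ) ≤ n := by exact_mod_cast hn
    push_cast
    nlinarith
  | succ j hj ih =>
    rw [prod_range_succ, prod_range_succ]
    refine mul_le_mul (ih (by omega)) (by omega) (by omega) (prod_nonneg fun i hi => ?_)
    have := mem_range.1 hi
    omega

theorem shellCoeff_succ_le_choose {n r : ℕ} (hr : 1 ≤ r) (hn : 2 ^ r * (r + 2) ≤ n)
    (h6 : ¬ (n = 6 ∧ r = 1)) (h2 : 2 * r + 3 ≤ n) :
    shellCoeff (n + 1) (r + 1) ≤ 2 * n.choose (r + 2) := by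
  have hf : (0 : ℤ) < (r + 2).factorial := by exact_mod_cast Nat.factorial_pos _
  refine le_of_mul_le_mul_left ?_ hf
  rw [mul_left_comm, factorial_mul_choose_eq_prod (p := r + 1) (by omega),
    Nat.factorial_succ (r + 1)]
  push_cast
  rw [mul_assoc, factorial_mul_shellCoeff (n + 1) (r + 1) (by omega)]
  have hprod : ∏ i ∈ range (r + 1), (((n + 1 : ℕ) : ℤ) - 2 * i - 1) =
      ∏ i ∈ range (r + 1), ((n : ℤ) - 2 * i) :=
    prod_congr rfl fun i _ => by push_cast; ring
  rw [hprod]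
  obtain rfl | hr2 : r = 1 ∨ 2 ≤ r := by omega
  · have : (7 : ℤ) ≤ n := by omega
    simp only [prod_range_succ, prod_range_zero]
    push_cast
    have h3 : (0 : ℤ) ≤ n * (n - 2) * (n - 7) := by
      refine mul_nonneg (mul_nonneg ?_ ?_) ?_ <;> linarith
    nlinarith
  · have hle := prod_sub_two_mul_le (n := n) (j := r + 1) (by omega) (by omega)
    have hn' : (2 : ℤ) ^ r * (r + 2) ≤ n := by exact_mod_cast hn
    have hnn : (0 : ℤ) ≤ ∏ i ∈ range (r + 1), ((n : ℤ) - 2 * i) :=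
      prod_nonneg fun i hi => by
        have := mem_range.1 hi
        omega
    have h3 := mul_le_mul hn' hle hnn (by positivity)
    rw [pow_succ]
    linarith

theorem detCost_le_of_eq_mul {n : ℕ} {x f : ℕ → ℤ} {c : ℤ} (hc : c ≠ 0)
    (h : ∀ w ≤ n, x w = c * f w) : detCost n f ≤ detCost n x := by
  refine sum_le_sum fun w hw => mul_le_mul_of_nonneg_left ?_ (Nat.cast_nonneg _)
  rw [h w (by have := mem_range.1 hw; omega), abs_mul]
  have : 1 ≤ |c| := Int.one_le_abs hc
  nlinarith [abs_nonneg (f w)]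

/-- For even `k`, a relation cheaper than `f` vanishes on the large sectors in the middle, so it is
a multiple of `f`. -/
theorem detCost_fEigenvalue_le_even {n p : ℕ} (hp : 1 ≤ p) (hn : 2 ^ p * (p + 1) ≤ n)
    {x : ℕ → ℤ} (hx : IsDetRelation n (p + p) x) (hx0 : ∃ w ≤ n, x w ≠ 0) :
    detCost n (fEigenvalue n (p + p + 1)) ≤ detCost n x := by
  have h2p : p + p + 1 ≤ n := by
    have : 2 ≤ 2 ^ p := by simpa using Nat.pow_le_pow_right (n := 2) (by norm_num) hp
    nlinarith
  obtain ⟨M, rfl⟩ : ∃ M, n = M + 1 + p + p := ⟨n - (p + p + 1), by omega⟩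
  set n := M + 1 + p + p with hn_def
  by_contra! hlt
  -- with `k = 2 p` the support of `f` consists of `p + 1` weights at either end
  have hcost : detCost n (fEigenvalue n (p + p + 1)) = 2 * shellCoeff n p := by
    rw [hn_def, detCost_fEigenvalue M p p (Or.inl rfl), shellSum_eq_shellCoeff]
    ring
  have hmid : ∀ w, p < w → w ≤ M + p → x w = 0 := by
    intro w h1 h2
    by_contra hne
    have h3 := hx.two_mul_choose_mul_abs_le (by omega) (show w ≤ n by omega)
    have h4 : (n.choose (p + 1) : ℤ) ≤ n.choose w := by
      exact_mod_cast choose_le_choose_of_mem_window (by omega) (by omega)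
    have h5 := shellCoeff_le_choose hn (by omega)
    nlinarith [Int.one_le_abs hne]
  have hfp : fEigenvalue n (p + p + 1) p = (-1) ^ p := by
    rw [hn_def, fEigenvalue_low M p p p (Or.inl rfl) le_rfl]
    simp
  have hsq : ((-1 : ℤ) ^ p) * (-1) ^ p = 1 := by rw [← mul_pow]; simp
  -- on the window `p, …, p + M` of length `n - k` only the entry at `p` survives
  have hy := (hx.linearComb (isDetRelation_fEigenvalue (n := n) (k := p + p) (by omega)) 1
    (-((-1) ^ p * x p))).eq_zero_of_window (a := p) (by omega) (by omega) (by
      intro w h1 h2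
      obtain rfl | h3 : w = p ∨ p < w := by omega
      · rw [hfp]
        linear_combination (-x w) * hsq
      · rw [hmid w h3 (by omega), hn_def, fEigenvalue_mid M p p w (Or.inl rfl) h3 (by omega)]
        ring)
  have hxf : ∀ w ≤ n, x w = ((-1) ^ p * x p) * fEigenvalue n (p + p + 1) w := by
    intro w hw
    linear_combination hy w hw
  refine absurd (detCost_le_of_eq_mul ?_ hxf) (not_le.2 hlt)
  intro hc
  obtain ⟨w, hw, hne⟩ := hx0
  exact hne (by rw [hxf w hw, hc, zero_mul])

theorem abs_add_abs_ge_of_add_ne_zero {a b F G : ℤ} (hF : 0 ≤ F) (hG : 0 ≤ G) (hab : a + b ≠ 0) :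
    F + G ≤ |a * F + b * G| + |a * G + b * F| := by
  have h1 : |(a + b) * (F + G)| ≤ |a * F + b * G| + |a * G + b * F| := by
    refine le_trans (le_of_eq ?_) (abs_add_le _ _)
    congr 1
    ring
  rw [abs_mul, abs_of_nonneg (add_nonneg hF hG)] at h1
  nlinarith [Int.one_le_abs hab]

/-- Term by term, since `3 * binom(n, v) ≤ binom(n, v + 1)` for `v ≤ r`. -/
theorem three_mul_shellSum_le {M r : ℕ} (h : 2 * r + 1 ≤ M) :
    3 * shellSum (M + 1 + (r + 1) + r) M r ≤ shellSum (M + 1 + (r + 1) + r) M (r + 1) := by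
  set n := M + 1 + (r + 1) + r with hn
  rw [shellSum, shellSum, sum_range_succ' _ (r + 1), mul_sum]
  refine le_add_of_le_of_nonneg (sum_le_sum fun v hv => ?_) (by positivity)
  have hv' := mem_range.1 hv
  rw [show M + (r + 1) - (v + 1) = M + r - v by omega, ← mul_assoc]
  refine mul_le_mul_of_nonneg_right ?_ (Nat.cast_nonneg _)
  have h1 := Nat.choose_succ_right_eq n v
  have h2 : 3 * n.choose v ≤ n.choose (v + 1) := by
    refine Nat.le_of_mul_le_mul_right ?_ (Nat.succ_pos v)
    rw [Nat.succ_eq_add_one, h1, mul_comm 3, mul_assoc]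
    exact Nat.mul_le_mul_left _ (by omega)
  exact_mod_cast h2

/-- For odd `k`, a relation cheaper than `f` vanishes on the large sectors in the middle, so it is
an integer combination `a f + b f'` of `f` and its reflection `f'`. The two have equal signs
everywhere, so only `a = -b` needs a comparison of the weights `F` and `G` at the two ends. -/
theorem detCost_fEigenvalue_le_odd {n r : ℕ} (hr : 1 ≤ r) (hn : 2 ^ r * (r + 2) ≤ n)
    (h6 : ¬ (n = 6 ∧ r = 1)) {x : ℕ → ℤ} (hx : IsDetRelation n (r + 1 + r) x)
    (hx0 : ∃ w ≤ n, x w ≠ 0) :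
    detCost n (fEigenvalue n (r + 1 + r + 1)) ≤ detCost n x := by
  have h4r : 4 * r + 3 ≤ n := by
    obtain rfl | hr2 : r = 1 ∨ 2 ≤ r := by omega
    · omega
    · have : 4 ≤ 2 ^ r := by simpa using Nat.pow_le_pow_right (n := 2) (by norm_num) hr2
      nlinarith
  obtain ⟨L, rfl⟩ : ∃ L, n = L + 1 + 1 + (r + 1) + r := ⟨n - (r + 1 + r + 2), by omega⟩
  set n := L + 1 + 1 + (r + 1) + r with hn_def
  have hLr : 2 * r ≤ L := by omega
  by_contra! hlt
  set f := fEigenvalue n (r + 1 + r + 1) with hf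
  have hpr : r = r + 1 ∨ r + 1 = r + 1 := Or.inr rfl
  have hcost : detCost n f = shellSum n (L + 1) (r + 1) + shellSum n (L + 1) r := by
    rw [hf, hn_def, detCost_fEigenvalue (L + 1) (r + 1) r hpr]
  have hcost2 : detCost n f = shellCoeff (n + 1) (r + 1) := by
    rw [hcost, hn_def, shellSum_succ_add_eq_shellCoeff]
  have hmid : ∀ w, r + 1 < w → w ≤ L + (r + 1) → x w = 0 := by
    intro w h1 h2
    by_contra hne
    have h3 := hx.two_mul_choose_mul_abs_le (by omega) (show w ≤ n by omega)
    have h4 : (n.choose (r + 2) : ℤ) ≤ n.choose w := by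
      exact_mod_cast choose_le_choose_of_mem_window (by omega) (by omega)
    have h5 := shellCoeff_succ_le_choose hr hn h6 (by omega)
    nlinarith [Int.one_le_abs hne]
  have hlow : ∀ v ≤ r + 1, f v = (-1) ^ v * ((L + 1 + (r + 1) - v).choose (L + 1) : ℤ) := by
    intro v hv
    rw [hf, hn_def, fEigenvalue_low (L + 1) (r + 1) r v hpr hv]
  have hmidf : ∀ w, r + 1 < w → w ≤ L + 1 + (r + 1) → f w = 0 := by
    intro w h1 h2
    rw [hf, hn_def, fEigenvalue_mid (L + 1) (r + 1) r w hpr h1 h2]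
  have hhigh : ∀ v ≤ r + 1, f (n - v) = (-1) ^ v * ((L + 1 + r - v).choose (L + 1) : ℤ) := by
    intro v hv
    obtain rfl | hv : v = r + 1 ∨ v ≤ r := by omega
    · rw [hmidf _ (by omega) (by omega), Nat.choose_eq_zero_of_lt (by omega)]
      simp
    · have he : (-1 : ℤ) ^ (r + 1 + r + 1) = 1 := Even.neg_one_pow ⟨r + 1, by ring⟩
      rw [hf, hn_def, fEigenvalue_high (L + 1) (r + 1) r v hpr hv, he, one_mul]
  have hfr := isDetRelation_fEigenvalue (n := n) (k := r + 1 + r) (by omega)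
  have hsq : ((-1 : ℤ) ^ (r + 1)) * (-1) ^ (r + 1) = 1 := by rw [← mul_pow]; simp
  -- on the window `r + 1, …, n - (r + 1)` of length `n - k` only the two end entries survive, and
  -- `f` and its reflection match one each
  set a := (-1) ^ (r + 1) * x (r + 1) with ha
  set b := (-1) ^ (r + 1) * x (n - (r + 1)) with hb
  have hy := (hx.linearComb (hfr.linearComb (hfr.reflect (by omega)) a b) 1 (-1)).eq_zero_of_window
    (a := r + 1) (by omega) (by omega) (by
      intro w h1 h2
      rw [← hf]
      obtain rfl | h3 : w = r + 1 ∨ r + 1 < w := by omega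
      · have e1 := hlow (r + 1) le_rfl
        have e2 := hhigh (r + 1) le_rfl
        rw [Nat.choose_eq_zero_of_lt (by omega)] at e2
        rw [Nat.add_sub_cancel, Nat.choose_self] at e1
        simp only [e1, e2, ha]
        push_cast
        linear_combination (-x (r + 1)) * hsq
      obtain rfl | h4 : w = n - (r + 1) ∨ w ≤ L + (r + 1) := by omega
      · have e1 := hlow (r + 1) le_rfl
        rw [Nat.add_sub_cancel, Nat.choose_self] at e1
        have e2 := hmidf (n - (r + 1)) (by omega) (by omega)
        simp only [e1, e2, hb, Nat.sub_sub_self (show r + 1 ≤ n by omega)]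
        push_cast
        linear_combination (-x (n - (r + 1))) * hsq
      · simp only [hmid w h3 h4, hmidf w h3 (by omega), hmidf (n - w) (by omega) (by omega)]
        ring)
  have hxf : ∀ w ≤ n, x w = a * f w + b * f (n - w) := by
    intro w hw
    linear_combination hy w hw
  set F : ℕ → ℤ := fun v => ((L + 1 + (r + 1) - v).choose (L + 1) : ℤ) with hF
  set G : ℕ → ℤ := fun v => ((L + 1 + r - v).choose (L + 1) : ℤ) with hG
  have hFG : ∀ v, G v ≤ F v := fun v => by
    simp only [hF, hG]
    exact_mod_cast Nat.choose_le_choose _ (by omega)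
  have hG0 : ∀ v, 0 ≤ G v := fun v => Nat.cast_nonneg _
  have hcx : detCost n x = ∑ v ∈ range (r + 2), (n.choose v : ℤ) *
      (|a * F v + b * G v| + |a * G v + b * F v|) := by
    have hn2 : n = L + 1 + (r + 1) + (r + 1) := by omega
    rw [detCost, show n + 1 = L + 1 + (r + 1) + (r + 1) + 1 by omega,
      sum_range_ends L (r + 1) (r + 1), ← hn2, ← sum_add_distrib]
    · refine sum_congr rfl fun v hv => ?_
      have hv' : v ≤ r + 1 := by have := mem_range.1 hv; omega
      have ev : |(-1 : ℤ) ^ v| = 1 := by rw [abs_pow]; simp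
      have e1 : x v = (-1) ^ v * (a * F v + b * G v) := by
        rw [hxf v (by omega), hlow v hv', hhigh v hv']
        ring
      have e2 : x (n - v) = (-1) ^ v * (a * G v + b * F v) := by
        rw [hxf (n - v) (by omega), Nat.sub_sub_self (by omega), hlow v hv', hhigh v hv']
        ring
      rw [Nat.choose_symm (by omega), e1, e2, abs_mul, abs_mul, ev]
      ring
    · intro w h1 h2
      rw [hmid w h1 h2, abs_zero, mul_zero]
  have hS1 : shellSum n (L + 1) (r + 1) = ∑ v ∈ range (r + 2), (n.choose v : ℤ) * F v := rfl
  have hS2 : shellSum n (L + 1) r = ∑ v ∈ range (r + 2), (n.choose v : ℤ) * G v := by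
    rw [sum_range_succ, shellSum]
    simp only [hG]
    rw [Nat.choose_eq_zero_of_lt (show L + 1 + r - (r + 1) < L + 1 by omega)]
    simp
  rw [hcost, hcx, hS1, hS2] at hlt
  refine absurd hlt (not_lt.2 ?_)
  by_cases hab : a + b = 0
  · have hb' : b = -a := by linarith
    have ha0 : a ≠ 0 := by
      intro ha0
      obtain ⟨w, hw, hne⟩ := hx0
      exact hne (by rw [hxf w hw, hb', ha0]; ring)
    have h3 := three_mul_shellSum_le (M := L + 1) (r := r) (by omega)
    rw [← hn_def, hS1, hS2] at h3
    have h4 : ∑ v ∈ range (r + 2), (2 * ((n.choose v : ℤ) * F v) - 2 * ((n.choose v : ℤ) * G v)) ≤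
        ∑ v ∈ range (r + 2), (n.choose v : ℤ) * (|a * F v + b * G v| + |a * G v + b * F v|) := by
      refine sum_le_sum fun v _ => ?_
      have e1 : a * F v + b * G v = a * (F v - G v) := by rw [hb']; ring
      have e2 : a * G v + b * F v = -(a * (F v - G v)) := by rw [hb']; ring
      have e3 : F v - G v ≤ |a * (F v - G v)| := by
        rw [abs_mul, abs_of_nonneg (sub_nonneg.2 (hFG v))]
        nlinarith [Int.one_le_abs ha0, hFG v]
      rw [e1, e2, abs_neg]
      have : (0 : ℤ) ≤ n.choose v := Nat.cast_nonneg _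
      nlinarith
    rw [sum_sub_distrib, ← mul_sum, ← mul_sum] at h4
    linarith
  · rw [← sum_add_distrib]
    refine sum_le_sum fun v _ => ?_
    rw [← mul_add]
    exact mul_le_mul_of_nonneg_left
      (abs_add_abs_ge_of_add_ne_zero ((hG0 v).trans (hFG v)) (hG0 v) hab) (Nat.cast_nonneg _)

/-- Here `binom(6, 3) = 20` is less than half of the cost `48` of `f`, so the middle sector is not
excluded by its dimension. The three middle entries determine a relation. -/
theorem detCost_fEigenvalue_le_six_three {x : ℕ → ℤ} (hx : IsDetRelation 6 3 x)
    (hx0 : ∃ w ≤ 6, x w ≠ 0) : detCost 6 (fEigenvalue 6 4) ≤ detCost 6 x := by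
  have hcost : detCost 6 (fEigenvalue 6 4) = 48 := by
    have h := detCost_fEigenvalue 2 2 1 (Or.inr rfl)
    norm_num at h
    rw [h]
    decide
  have e0 := hx 0 (by norm_num)
  have e1 := hx 1 (by norm_num)
  have e2 := hx 2 (by norm_num)
  have e3 := hx 3 (by norm_num)
  norm_num [sum_range_succ, Nat.choose] at e0 e1 e2 e3
  rw [hcost]
  norm_num [detCost, sum_range_succ, Nat.choose]
  have hne : ¬ (x 2 = 0 ∧ x 3 = 0 ∧ x 4 = 0) := by
    rintro ⟨h2, h3, h4⟩
    obtain ⟨w, hw, hw0⟩ := hx0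
    interval_cases w <;> omega
  generalize x 0 = x0 at *
  generalize x 1 = x1 at *
  generalize x 2 = x2 at *
  generalize x 3 = x3 at *
  generalize x 4 = x4 at *
  generalize x 5 = x5 at *
  generalize x 6 = x6 at *
  by_contra! hlt
  have p0 := abs_nonneg x0
  have p1 := abs_nonneg x1
  have p2 := abs_nonneg x2
  have p3 := abs_nonneg x3
  have p4 := abs_nonneg x4
  have p5 := abs_nonneg x5
  have p6 := abs_nonneg x6
  obtain ⟨_, _⟩ := abs_le.1 (show |x2| ≤ 3 by omega)
  obtain ⟨_, _⟩ := abs_le.1 (show |x3| ≤ 2 by omega)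
  obtain ⟨_, _⟩ := abs_le.1 (show |x4| ≤ 3 by omega)
  rw [show x1 = -3 * x2 - 3 * x3 - x4 by omega, show x5 = -x2 - 3 * x3 - 3 * x4 by omega,
    show x0 = 6 * x2 + 8 * x3 + 3 * x4 by omega, show x6 = 3 * x2 + 8 * x3 + 6 * x4 by omega] at hlt
  clear e0 e1 e2 e3 hcost hx hx0 p0 p1 p2 p3 p4 p5 p6
  interval_cases x2 <;> interval_cases x3 <;> interval_cases x4 <;>
    first
    | exact absurd hlt (by decide)
    | exact hne (by decide)

/-! ### Hamming weights -/

theorem hammingNorm_eq_sum {ι : Type*} [Fintype ι] (x : ι → Fin 2) :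
    hammingNorm x = ∑ i, (x i : ℕ) := by
  rw [hammingNorm, card_filter]
  refine sum_congr rfl fun i _ => ?_
  generalize x i = a
  fin_cases a <;> rfl

theorem card_hammingNorm_eq (ι : Type*) [Fintype ι] [DecidableEq ι] (j : ℕ) :
    #{x : ι → Fin 2 | hammingNorm x = j} = (Fintype.card ι).choose j := by
  rw [← card_univ, ← card_powersetCard]
  refine card_nbij' (fun x => univ.filter fun i => x i ≠ 0) (fun s i => if i ∈ s then 1 else 0)
    ?_ ?_ ?_ ?_
  · intro x hx
    simpa [mem_powersetCard, hammingNorm] using hx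
  · intro s hs
    simpa [mem_powersetCard, hammingNorm] using hs
  · intro x _
    funext i
    have : ∀ a : Fin 2, (if a ≠ 0 then (1 : Fin 2) else 0) = a := by decide
    simpa using this (x i)
  · intro s _
    ext i
    simp

theorem hammingNorm_le {n : ℕ} (x : Fin n → Fin 2) : hammingNorm x ≤ n := by
  simpa using hammingNorm_le_card_fintype (x := x)

theorem sum_comp_hammingNorm {R : Type*} [CommSemiring R] (ι : Type*) [Fintype ι] [DecidableEq ι]
    (g : ℕ → R) :
    ∑ x : ι → Fin 2, g (hammingNorm x) =
      ∑ i ∈ range (Fintype.card ι + 1), ((Fintype.card ι).choose i : R) * g i := by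
  rw [← sum_fiberwise_of_maps_to (s := univ) (t := range (Fintype.card ι + 1))
    (g := fun x : ι → Fin 2 => hammingNorm x)
    (fun x _ => mem_range.2 (Nat.lt_succ_of_le hammingNorm_le_card_fintype))]
  refine sum_congr rfl fun i _ => ?_
  rw [← card_hammingNorm_eq ι i, ← nsmul_eq_mul, ← sum_const]
  refine sum_congr rfl fun x hx => ?_
  rw [(mem_filter.1 hx).2]

/-- The qubits in and outside `S` share the weight. -/
theorem hammingNorm_restrict_add {n : ℕ} (S : Finset (Fin n)) (x : Fin n → Fin 2) :
    hammingNorm (fun i : {i // i ∈ S} => x i) + hammingNorm (fun i : {i // i ∉ S} => x i) =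
      hammingNorm x := by
  rw [hammingNorm_eq_sum, hammingNorm_eq_sum, hammingNorm_eq_sum]
  convert Fintype.sum_subtype_add_sum_subtype (fun i => i ∈ S) (fun i => (x i : ℕ))

/-! ### Symmetric operators and their sector determinants -/

theorem tensorPow_chargeRep (n : ℕ) (θ : ℝ) :
    tensorPow n (chargeRep θ) = Matrix.diagonal fun x : Fin n → Fin 2 =>
      Complex.exp (Complex.I * θ * ((n : ℂ) - 2 * hammingNorm x)) := by
  ext x y
  rw [tensorPow, Matrix.of_apply, Matrix.diagonal_apply]
  split_ifs with h
  · subst h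
    have h1 : ∀ a : Fin 2, chargeRep θ a a = Complex.exp (Complex.I * θ * (1 - 2 * ((a : ℕ) : ℂ))) := by
      intro a
      fin_cases a
      · simp [chargeRep]
      · simp only [chargeRep, Matrix.diagonal_apply_eq]
        simp only [Fin.mk_one, Matrix.cons_val_one, Matrix.cons_val_fin_one, Nat.cast_one]
        congr 1
        ring
    rw [prod_congr rfl fun i _ => h1 (x i), ← Complex.exp_sum, ← mul_sum, sum_sub_distrib, ← mul_sum,
      hammingNorm_eq_sum]
    simp
  · obtain ⟨i, hi⟩ := Function.ne_iff.1 h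
    exact prod_eq_zero (mem_univ i) (by simp [chargeRep, Matrix.diagonal_apply_ne _ hi])

theorem isSymmetric_iff {n : ℕ} {V : QubitOp n} :
    IsSymmetric V ↔ ∀ x y, hammingNorm x ≠ hammingNorm y → V x y = 0 := by
  constructor
  · intro h x y hxy
    set d : ℝ := (hammingNorm x : ℝ) - hammingNorm y with hd
    have hd0 : d ≠ 0 := sub_ne_zero.2 (by exact_mod_cast hxy)
    have h1 := congrFun (congrFun (h (Real.pi / (2 * d))) x) y
    rw [tensorPow_chargeRep, Matrix.mul_diagonal, Matrix.diagonal_mul] at h1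
    have h2 : Complex.exp (Complex.I * ((Real.pi / (2 * d) : ℝ) : ℂ) * ((n : ℂ) - 2 * hammingNorm y)) =
        - Complex.exp (Complex.I * ((Real.pi / (2 * d) : ℝ) : ℂ) * ((n : ℂ) - 2 * hammingNorm x)) := by
      rw [← neg_one_mul, ← Complex.exp_pi_mul_I, ← Complex.exp_add]
      congr 1
      have hd0' : (d : ℂ) ≠ 0 := by exact_mod_cast hd0
      push_cast
      have hdc : (d : ℂ) = (hammingNorm x : ℂ) - hammingNorm y := by rw [hd]; push_cast; ring
      field_simp
      rw [hdc]
      ring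
    rw [h2] at h1
    have h3 : V x y * Complex.exp
        (Complex.I * ((Real.pi / (2 * d) : ℝ) : ℂ) * ((n : ℂ) - 2 * hammingNorm x)) = 0 := by
      linear_combination (-1 / 2) * h1
    exact (mul_eq_zero.1 h3).resolve_right (Complex.exp_ne_zero _)
  · intro h θ
    rw [tensorPow_chargeRep]
    ext x y
    rw [Matrix.mul_diagonal, Matrix.diagonal_mul]
    by_cases hxy : hammingNorm x = hammingNorm y
    · rw [hxy, mul_comm]
    · rw [h x y hxy, zero_mul, mul_zero]

theorem isSymmetric_diagonal {n : ℕ} (v : (Fin n → Fin 2) → ℂ) :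
    IsSymmetric (Matrix.diagonal v : QubitOp n) :=
  isSymmetric_iff.2 fun _ _ hxy => Matrix.diagonal_apply_ne _ fun h => hxy (by rw [h])

/-- The determinant of the block of `V` on the sector of Hamming weight `w`. -/
noncomputable def sectorDet {n : ℕ} (w : ℕ) (V : QubitOp n) : ℂ :=
  (V.submatrix (Subtype.val : {x : Fin n → Fin 2 // hammingNorm x = w} → _) Subtype.val).det

theorem sectorDet_mul {n : ℕ} {V : QubitOp n} (hV : IsSymmetric V) (W : QubitOp n) (w : ℕ) :
    sectorDet w (V * W) = sectorDet w V * sectorDet w W := by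
  rw [sectorDet, sectorDet, sectorDet, ← Matrix.det_mul]
  congr 1
  ext x y
  rw [Matrix.submatrix_apply, Matrix.mul_apply, Matrix.mul_apply,
    ← Fintype.sum_subtype_add_sum_subtype (fun z => hammingNorm z = w)]
  refine add_eq_left.2 (Finset.sum_eq_zero fun z _ => ?_)
  rw [isSymmetric_iff.1 hV _ _ (fun h => z.2 (h ▸ x.2)), zero_mul]

theorem sectorDet_one {n : ℕ} (w : ℕ) : sectorDet w (1 : QubitOp n) = 1 := by
  rw [sectorDet, Matrix.submatrix_one _ Subtype.val_injective, Matrix.det_one]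

theorem sectorDet_star {n : ℕ} (w : ℕ) (V : QubitOp n) :
    sectorDet w (star V) = star (sectorDet w V) := by
  rw [sectorDet, sectorDet, ← Matrix.det_conjTranspose, Matrix.conjTranspose_submatrix]
  rfl

theorem sectorDet_diagonal {n : ℕ} (w : ℕ) (v : (Fin n → Fin 2) → ℂ) :
    sectorDet w (Matrix.diagonal v : QubitOp n) = ∏ x with hammingNorm x = w, v x := by
  rw [sectorDet, Matrix.submatrix_diagonal _ _ Subtype.val_injective, Matrix.det_diagonal,
    prod_subtype (univ.filter fun x : Fin n → Fin 2 => hammingNorm x = w)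
      (p := fun x => hammingNorm x = w) (by simp)]
  rfl

theorem sectorDet_mul_star {n : ℕ} {V : QubitUnitary n} (hV : V ∈ symmetricGroup n) (w : ℕ) :
    sectorDet w (V : QubitOp n) * star (sectorDet w (V : QubitOp n)) = 1 := by
  rw [← sectorDet_star, ← sectorDet_mul hV, Matrix.mem_unitaryGroup_iff.1 V.2, sectorDet_one]

theorem sectorDet_ne_zero {n : ℕ} {V : QubitUnitary n} (hV : V ∈ symmetricGroup n) (w : ℕ) :
    sectorDet w (V : QubitOp n) ≠ 0 :=
  left_ne_zero_of_mul_eq_one (sectorDet_mul_star hV w)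

/-- The monomial `∏ det(V_w) ^ x_w` in the sector determinants, with `det(V_w)⁻¹` replaced by
the complex conjugate of `det(V_w)`, so that it is a polynomial in the entries of `V` and `V^*`. -/
noncomputable def detMonomial (n : ℕ) (x : ℕ → ℤ) (V : QubitOp n) : ℂ :=
  ∏ w ∈ range (n + 1), sectorDet w V ^ (x w).toNat * star (sectorDet w V) ^ (-x w).toNat

theorem pow_toNat_mul_star_pow_toNat {z : ℂ} (hz : z * star z = 1) (a : ℤ) :
    z ^ a.toNat * star z ^ (-a).toNat = z ^ a := by
  rw [eq_inv_of_mul_eq_one_right hz]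
  obtain ⟨m, rfl | rfl⟩ := a.eq_nat_or_neg
  · simp
  · simp

theorem detMonomial_eq_zpow {n : ℕ} (x : ℕ → ℤ) {V : QubitUnitary n} (hV : V ∈ symmetricGroup n) :
    detMonomial n x V = ∏ w ∈ range (n + 1), sectorDet w (V : QubitOp n) ^ x w :=
  prod_congr rfl fun w _ => pow_toNat_mul_star_pow_toNat (sectorDet_mul_star hV w) (x w)

theorem detMonomial_mul {n : ℕ} (x : ℕ → ℤ) {V : QubitOp n} (hV : IsSymmetric V) (W : QubitOp n) :
    detMonomial n x (V * W) = detMonomial n x V * detMonomial n x W := by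
  rw [detMonomial, detMonomial, detMonomial, ← prod_mul_distrib]
  refine prod_congr rfl fun w _ => ?_
  rw [sectorDet_mul hV, star_mul', mul_pow, mul_pow]
  ring

theorem detMonomial_one {n : ℕ} (x : ℕ → ℤ) : detMonomial n x (1 : QubitOp n) = 1 := by
  simp [detMonomial, sectorDet_one]

/-! ### Sector determinants of local operators -/

/-- The determinant of the block of `A` on the weight-`j` vectors of the qubits in `ι`. -/
noncomputable def weightDet {ι : Type*} [Fintype ι] [DecidableEq ι]
    (A : Matrix (ι → Fin 2) (ι → Fin 2) ℂ) (j : ℕ) : ℂ :=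
  (A.submatrix (Subtype.val : {a : ι → Fin 2 // hammingNorm a = j} → _) Subtype.val).det

/-- Fixing the qubits outside `S` splits each sector of an operator on `S` into blocks. -/
theorem sectorDet_of_local {n : ℕ} (S : Finset (Fin n))
    (A : Matrix ({i // i ∈ S} → Fin 2) ({i // i ∈ S} → Fin 2) ℂ) (V : QubitOp n)
    (hV : ∀ x y : Fin n → Fin 2, V x y =
      if ∀ i, i ∉ S → x i = y i then A (fun i => x i) (fun i => y i) else 0) (w : ℕ) :
    sectorDet w V = ∏ y : {i // i ∉ S} → Fin 2,
      if hammingNorm y ≤ w then weightDet A (w - hammingNorm y) else 1 := by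
  -- the blocks are labelled by the bits outside `S`, which `V` preserves
  set e := Fintype.equivFin ({i // i ∉ S} → Fin 2)
  set b : {x : Fin n → Fin 2 // hammingNorm x = w} → Fin (Fintype.card ({i // i ∉ S} → Fin 2)) :=
    fun x => e fun i => x.1 i with hb
  have hne : ∀ x y : {x : Fin n → Fin 2 // hammingNorm x = w}, b x ≠ b y → V x y = 0 := by
    intro x y hxy
    rw [hV, if_neg]
    intro h
    apply hxy
    simp only [hb]
    congr 1
    funext i
    exact h i i.2
  have htri : Matrix.BlockTriangular (V.submatrix
      (Subtype.val : {x : Fin n → Fin 2 // hammingNorm x = w} → _) Subtype.val) b :=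
    fun x y hxy => hne x y hxy.ne'
  rw [sectorDet, htri.det_fintype, ← e.prod_comp]
  refine prod_congr rfl fun y _ => ?_
  split_ifs with hy
  · let g : {a : {i // i ∈ S} → Fin 2 // hammingNorm a = w - hammingNorm y} ≃
        {x : {x : Fin n → Fin 2 // hammingNorm x = w} // b x = e y} :=
      { toFun := fun a => ⟨⟨(Equiv.piEquivPiSubtypeProd (fun i => i ∈ S) fun _ => Fin 2).symm (a.1, y),
          by
            rw [← hammingNorm_restrict_add S]
            have := a.2
            simp only [Equiv.piEquivPiSubtypeProd_symm_apply, Subtype.coe_eta]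
            have h1 : (fun i : {i // i ∈ S} => if h : (i : Fin n) ∈ S then a.1 i else
                y ⟨i, h⟩) = a.1 := by
              funext i
              rw [dif_pos i.2]
            have h2 : (fun i : {i // i ∉ S} => if h : (i : Fin n) ∈ S then a.1 ⟨i, h⟩ else
                y ⟨i, h⟩) = y := by
              funext i
              rw [dif_neg i.2]
            rw [h1, h2]
            omega⟩,
          by
            simp only [hb, Equiv.piEquivPiSubtypeProd_symm_apply]
            congr 1
            funext i
            rw [dif_neg i.2]⟩
        invFun := fun x => ⟨fun i => x.1.1 i, by
          have h1 := hammingNorm_restrict_add S x.1.1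
          have h2 := x.1.2
          have h3 : (fun i : {i // i ∉ S} => x.1.1 i) = y := e.injective x.2
          rw [h3] at h1
          omega⟩
        left_inv := fun a => by
          apply Subtype.ext
          funext i
          simp
        right_inv := fun x => by
          apply Subtype.ext
          apply Subtype.ext
          funext i
          have h3 : (fun i : {i // i ∉ S} => x.1.1 i) = y := e.injective x.2
          by_cases hi : i ∈ S
          · simp [Equiv.piEquivPiSubtypeProd_symm_apply, hi]
          · simp [Equiv.piEquivPiSubtypeProd_symm_apply, hi, ← h3] }
    rw [weightDet, ← Matrix.det_submatrix_equiv_self g]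
    congr 1
    ext a a'
    simp only [Matrix.submatrix_apply, Matrix.toSquareBlock_def, Matrix.of_apply]
    rw [hV, if_pos]
    · congr 1 <;> funext i <;> simp [g, Equiv.piEquivPiSubtypeProd_symm_apply]
    · intro i hi
      simp [g, Equiv.piEquivPiSubtypeProd_symm_apply, hi]
  · have : IsEmpty {x : {x : Fin n → Fin 2 // hammingNorm x = w} // b x = e y} := by
      refine ⟨fun x => hy ?_⟩
      have h1 := hammingNorm_restrict_add S x.1.1
      have h2 := x.1.2
      have h3 : (fun i : {i // i ∉ S} => x.1.1 i) = y := e.injective x.2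
      rw [h3] at h1
      omega
    exact Matrix.det_isEmpty

theorem weightDet_eq_one_of_lt {ι : Type*} [Fintype ι] [DecidableEq ι]
    (A : Matrix (ι → Fin 2) (ι → Fin 2) ℂ) {j : ℕ} (hj : Fintype.card ι < j) :
    weightDet A j = 1 := by
  have : IsEmpty {a : ι → Fin 2 // hammingNorm a = j} :=
    ⟨fun a => by
      have := hammingNorm_le_card_fintype (x := a.1)
      rw [a.2] at this
      omega⟩
  exact Matrix.det_isEmpty

theorem prod_zpow_eq_zpow_sum {ι : Type*} (s : Finset ι) {z : ℂ} (hz : z ≠ 0) (f : ι → ℤ) :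
    ∏ i ∈ s, z ^ f i = z ^ ∑ i ∈ s, f i := by
  classical
  induction s using Finset.induction_on with
  | empty => simp
  | insert a s ha ih => rw [prod_insert ha, sum_insert ha, ih, zpow_add₀ hz]

/-- The weight-`j` block of an operator on `m ≤ k` qubits occurs `binom(n - m, i)` times in the sector
of weight `j + i`, so its determinant enters the monomial with exponent
`∑ i, binom(n - m, i) * x (j + i) = 0`. -/
theorem detMonomial_eq_one_of_isLocal {n k : ℕ} (hk : k ≤ n) {x : ℕ → ℤ}
    (hx : IsDetRelation n k x) {V : QubitUnitary n} (hV : V ∈ symmetricGroup n)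
    (hloc : IsLocal k (V : QubitOp n)) : detMonomial n x V = 1 := by
  obtain ⟨S, hS, A, hA⟩ := hloc
  have hx' := hx.mono hk hS
  have hdet := sectorDet_of_local S A V hA
  have hcardS : Fintype.card {i // i ∈ S} = S.card := by simp
  have hcardT : Fintype.card {i // i ∉ S} = n - S.card := by
    rw [Fintype.card_subtype_compl, Fintype.card_fin, hcardS]
  have hTle : ∀ y : {i // i ∉ S} → Fin 2, hammingNorm y ≤ n - S.card := fun y =>
    hcardT ▸ hammingNorm_le_card_fintype
  have hA0 : ∀ j, weightDet A j ≠ 0 := by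
    intro j
    have h := sectorDet_ne_zero hV j
    rw [hdet, prod_ne_zero_iff] at h
    simpa using h 0 (mem_univ _)
  rw [detMonomial_eq_zpow x hV]
  have h1 : ∀ w, sectorDet w (V : QubitOp n) ^ x w = ∏ y : {i // i ∉ S} → Fin 2,
      (if hammingNorm y ≤ w then weightDet A (w - hammingNorm y) else 1) ^ x w := by
    intro w
    rw [hdet, prod_zpow]
  rw [prod_congr rfl fun w _ => h1 w, prod_comm]
  have h2 : ∀ y : {i // i ∉ S} → Fin 2, ∏ w ∈ range (n + 1),
      (if hammingNorm y ≤ w then weightDet A (w - hammingNorm y) else 1) ^ x w =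
      ∏ j ∈ range (S.card + 1), weightDet A j ^ x (j + hammingNorm y) := by
    intro y
    have hy := hTle y
    have hSn : S.card ≤ n := by simpa using card_le_univ S
    symm
    refine prod_of_injOn (fun j => j + hammingNorm y) (fun a _ b _ h => by simpa using h) ?_ ?_ ?_
    · intro j hj
      have := mem_range.1 (mem_coe.1 hj)
      exact mem_coe.2 (mem_range.2 (show j + hammingNorm y < n + 1 by omega))
    · intro w hw hw'
      split_ifs with hle
      · rw [weightDet_eq_one_of_lt, one_zpow]
        rw [hcardS]
        by_contra hcon
        exact hw' ⟨w - hammingNorm y, mem_coe.2 (mem_range.2 (by omega)), by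
          simp only
          omega⟩
      · exact one_zpow _
    · intro j _
      rw [if_pos (Nat.le_add_left _ _), Nat.add_sub_cancel]
  rw [prod_congr rfl fun y _ => h2 y, prod_comm]
  refine prod_eq_one fun j hj => ?_
  rw [prod_zpow_eq_zpow_sum _ (hA0 j),
    sum_comp_hammingNorm {i // i ∉ S} (fun i => x (j + i)), hcardT,
    hx' j (by have := mem_range.1 hj; omega), zpow_zero]

theorem circuitGroup_le_symmetricGroup (n k : ℕ) : circuitGroup n k ≤ symmetricGroup n :=
  (Subgroup.closure_le _).2 fun _ hV => hV.1

theorem detMonomial_inv_eq_one {n : ℕ} {x : ℕ → ℤ} {V : QubitUnitary n} (hV : V ∈ symmetricGroup n)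
    (h : detMonomial n x V = 1) : detMonomial n x (V⁻¹ : QubitUnitary n) = 1 := by
  have h1 := detMonomial_mul x hV ((V⁻¹ : QubitUnitary n) : QubitOp n)
  rw [h, one_mul, ← Submonoid.coe_mul, mul_inv_cancel, Submonoid.coe_one, detMonomial_one] at h1
  exact h1.symm

theorem detMonomial_eq_one_of_mem_circuitGroup {n k : ℕ} (hk : k ≤ n) {x : ℕ → ℤ}
    (hx : IsDetRelation n k x) {V : QubitUnitary n} (hV : V ∈ circuitGroup n k) :
    detMonomial n x V = 1 := by
  induction hV using Subgroup.closure_induction with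
  | mem V hV => exact detMonomial_eq_one_of_isLocal hk hx hV.1 hV.2
  | one => exact detMonomial_one x
  | mul V W hV _ h1 h2 =>
    rw [Submonoid.coe_mul, detMonomial_mul x (circuitGroup_le_symmetricGroup n k hV), h1, h2,
      one_mul]
  | inv V hV h => exact detMonomial_inv_eq_one (circuitGroup_le_symmetricGroup n k hV) h

/-! ### Gates pairing basis states by an involution -/

/-- The operator with `(G v) x = p x * v x + q x * v (τ x)`. -/
def pairGate {X : Type*} [DecidableEq X] (τ : X → X) (p q : X → ℂ) : Matrix X X ℂ :=
  Matrix.of fun x y => (if y = x then p x else 0) + (if y = τ x then q x else 0)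

section pairGate

variable {X : Type*} [DecidableEq X]

theorem pairGate_mulVec [Fintype X] (τ : X → X) (p q v : X → ℂ) (x : X) :
    (pairGate τ p q *ᵥ v) x = p x * v x + q x * v (τ x) := by
  simp [pairGate, Matrix.mulVec, dotProduct, add_mul, sum_add_distrib]

theorem eq_of_mulVec_eq [Fintype X] {A B : Matrix X X ℂ} (h : ∀ v x, (A *ᵥ v) x = (B *ᵥ v) x) : A = B := by
  ext x y
  simpa using h (Pi.single y 1) x

theorem pairGate_mul [Fintype X] {τ : X → X} (hτ : ∀ x, τ (τ x) = x) (p q p' q' : X → ℂ) :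
    pairGate τ p q * pairGate τ p' q' =
      pairGate τ (fun x => p x * p' x + q x * q' (τ x)) (fun x => p x * q' x + q x * p' (τ x)) := by
  refine eq_of_mulVec_eq fun v x => ?_
  rw [← Matrix.mulVec_mulVec]
  simp only [pairGate_mulVec, hτ]
  ring

theorem pairGate_star {τ : X → X} (hτ : ∀ x, τ (τ x) = x) (p q : X → ℂ) :
    star (pairGate τ p q) = pairGate τ (fun x => conj (p x)) (fun x => conj (q (τ x))) := by
  ext x y
  have h : x = τ y ↔ y = τ x := ⟨fun h => by rw [h, hτ], fun h => by rw [h, hτ]⟩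
  rw [Matrix.star_apply, pairGate, pairGate, Matrix.of_apply, Matrix.of_apply, star_add]
  congr 1
  · by_cases hxy : y = x
    · simp [hxy]
    · simp [hxy, Ne.symm hxy]
  · by_cases hxy : y = τ x
    · rw [if_pos hxy, if_pos (h.2 hxy), hxy]
      rfl
    · rw [if_neg hxy, if_neg (fun h' => hxy (h.1 h')), star_zero]

theorem diagonal_eq_pairGate [Fintype X] (τ : X → X) (d : X → ℂ) :
    Matrix.diagonal d = pairGate τ d (fun _ => 0) := by
  refine eq_of_mulVec_eq fun v x => ?_
  rw [Matrix.mulVec_diagonal, pairGate_mulVec]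
  ring

end pairGate

/-! ### Locality -/

theorem isLocal_of_restrict {n k : ℕ} (S : Finset (Fin n)) (hS : S.card ≤ k) (V : QubitOp n)
    (h0 : ∀ x y, (∃ i, i ∉ S ∧ x i ≠ y i) → V x y = 0)
    (h1 : ∀ x y x' y', (∀ i ∈ S, x i = x' i) → (∀ i ∈ S, y i = y' i) → (∀ i, i ∉ S → x i = y i) →
      (∀ i, i ∉ S → x' i = y' i) → V x y = V x' y') : IsLocal k V := by
  refine ⟨S, hS, Matrix.of fun u v => V (fun i => if h : i ∈ S then u ⟨i, h⟩ else 0)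
    (fun i => if h : i ∈ S then v ⟨i, h⟩ else 0), fun x y => ?_⟩
  split_ifs with h
  · refine h1 _ _ _ _ ?_ ?_ h ?_
    · intro i hi
      simp [hi]
    · intro i hi
      simp [hi]
    · intro i hi
      simp [hi]
  · push Not at h
    exact h0 x y h

theorem isLocal_diagonal {n k : ℕ} (S : Finset (Fin n)) (hS : S.card ≤ k)
    (d : (Fin n → Fin 2) → ℂ) (hd : ∀ x y, (∀ i ∈ S, x i = y i) → d x = d y) :
    IsLocal k (Matrix.diagonal d : QubitOp n) := by
  refine isLocal_of_restrict S hS _ ?_ ?_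
  · rintro x y ⟨i, _, hi⟩
    exact Matrix.diagonal_apply_ne _ fun h => hi (by rw [h])
  · intro x y x' y' hx hy hxy hxy'
    have key : x = y ↔ x' = y' := by
      constructor
      · rintro rfl
        funext i
        by_cases hi : i ∈ S
        · rw [← hx i hi, ← hy i hi]
        · exact hxy' i hi
      · rintro rfl
        funext i
        by_cases hi : i ∈ S
        · rw [hx i hi, hy i hi]
        · exact hxy i hi
    rw [Matrix.diagonal_apply, Matrix.diagonal_apply]
    simp only [key, hd x x' hx]

/-! ### Circuits with trivial sector determinants -/

/-- The operators implemented by `k`-local symmetric circuits. -/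
def IsCircuit {n : ℕ} (k : ℕ) (V : QubitOp n) : Prop :=
  ∃ U ∈ circuitGroup n k, (U : QubitOp n) = V

/-- The circuits all of whose sector determinants are `1`. -/
def IsSpecialCircuit {n : ℕ} (k : ℕ) (V : QubitOp n) : Prop :=
  IsCircuit k V ∧ ∀ w, sectorDet w V = 1

theorem IsCircuit.mul {n k : ℕ} {V W : QubitOp n} (hV : IsCircuit k V) (hW : IsCircuit k W) :
    IsCircuit k (V * W) := by
  obtain ⟨U, hU, rfl⟩ := hV
  obtain ⟨U', hU', rfl⟩ := hW
  exact ⟨U * U', mul_mem hU hU', rfl⟩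

theorem IsCircuit.star {n k : ℕ} {V : QubitOp n} (hV : IsCircuit k V) : IsCircuit k (star V) := by
  obtain ⟨U, hU, rfl⟩ := hV
  exact ⟨U⁻¹, inv_mem hU, rfl⟩

theorem IsCircuit.isSymmetric {n k : ℕ} {V : QubitOp n} (hV : IsCircuit k V) : IsSymmetric V := by
  obtain ⟨U, hU, rfl⟩ := hV
  exact circuitGroup_le_symmetricGroup n k hU

theorem IsCircuit.star_mul_self {n k : ℕ} {V : QubitOp n} (hV : IsCircuit k V) :
    Star.star V * V = 1 := by
  obtain ⟨U, _, rfl⟩ := hV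
  exact Matrix.mem_unitaryGroup_iff'.1 U.2

theorem IsCircuit.mul_star_self {n k : ℕ} {V : QubitOp n} (hV : IsCircuit k V) :
    V * Star.star V = 1 := by
  obtain ⟨U, _, rfl⟩ := hV
  exact Matrix.mem_unitaryGroup_iff.1 U.2

theorem IsSpecialCircuit.one {n k : ℕ} : IsSpecialCircuit k (1 : QubitOp n) :=
  ⟨⟨1, one_mem _, rfl⟩, sectorDet_one⟩

theorem IsSpecialCircuit.mul {n k : ℕ} {V W : QubitOp n} (hV : IsSpecialCircuit k V)
    (hW : IsSpecialCircuit k W) : IsSpecialCircuit k (V * W) :=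
  ⟨hV.1.mul hW.1, fun w => by rw [sectorDet_mul hV.1.isSymmetric, hV.2, hW.2, one_mul]⟩

theorem IsSpecialCircuit.star {n k : ℕ} {V : QubitOp n} (hV : IsSpecialCircuit k V) :
    IsSpecialCircuit k (star V) :=
  ⟨hV.1.star, fun w => by rw [sectorDet_star, hV.2, star_one]⟩

/-- The commutator of a circuit with a diagonal reflection is special. -/
theorem IsCircuit.commutator {n k : ℕ} {U D : QubitOp n} (hU : IsCircuit k U)
    (hD : IsCircuit k D) (hDD : D * D = 1) :
    IsSpecialCircuit k (U * (D * Star.star U * D)) := by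
  refine ⟨hU.mul ((hD.mul hU.star).mul hD), fun w => ?_⟩
  have h1 : sectorDet w D * sectorDet w D = 1 := by
    rw [← sectorDet_mul hD.isSymmetric, hDD, sectorDet_one]
  have h2 : sectorDet w U * sectorDet w (Star.star U) = 1 := by
    rw [← sectorDet_mul hU.isSymmetric, hU.mul_star_self, sectorDet_one]
  rw [sectorDet_mul hU.isSymmetric, sectorDet_mul (hD.mul hU.star).isSymmetric,
    sectorDet_mul hD.isSymmetric]
  linear_combination (sectorDet w U * sectorDet w (Star.star U)) * h1 + h2

/-! ### Controlled rotations -/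

/-- Exchange the values of the qubits `a` and `b`. -/
def swapBits {n : ℕ} (a b : Fin n) (x : Fin n → Fin 2) : Fin n → Fin 2 := x ∘ Equiv.swap a b

section swapBits

variable {n : ℕ} {a b : Fin n}

theorem swapBits_swapBits (x : Fin n → Fin 2) : swapBits a b (swapBits a b x) = x := by
  funext i
  simp [swapBits]

theorem swapBits_left (x : Fin n → Fin 2) : swapBits a b x a = x b := by simp [swapBits]

theorem swapBits_right (x : Fin n → Fin 2) : swapBits a b x b = x a := by simp [swapBits]

theorem swapBits_of_ne (x : Fin n → Fin 2) {i : Fin n} (ha : i ≠ a) (hb : i ≠ b) :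
    swapBits a b x i = x i := by
  simp [swapBits, Equiv.swap_apply_of_ne_of_ne ha hb]

theorem hammingNorm_swapBits (x : Fin n → Fin 2) : hammingNorm (swapBits a b x) = hammingNorm x := by
  rw [hammingNorm_eq_sum, hammingNorm_eq_sum]
  exact Equiv.sum_comp (Equiv.swap a b) fun i => (x i : ℕ)

end swapBits

open Classical in
/-- The rotation by `c`, `z` in the plane spanned by the states `01` and `10` of the qubits `a` and
`b`, controlled on `Q`. -/
noncomputable def rotGate {n : ℕ} (a b : Fin n) (Q : (Fin n → Fin 2) → Prop) (c : ℝ) (z : ℂ) :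
    QubitOp n :=
  pairGate (swapBits a b) (fun x => if Q x ∧ x a ≠ x b then (c : ℂ) else 1)
    (fun x => if Q x ∧ x a ≠ x b then (if x a = 1 then z else -conj z) else 0)

open Classical in
/-- The sign flip of the qubit `a`, controlled on `R`. -/
noncomputable def signGate {n : ℕ} (a : Fin n) (R : (Fin n → Fin 2) → Prop) : QubitOp n :=
  Matrix.diagonal fun x => if R x ∧ x a = 1 then -1 else 1

theorem signGate_mul_self {n : ℕ} (a : Fin n) (R : (Fin n → Fin 2) → Prop) :
    signGate a R * signGate a R = 1 := by
  rw [signGate, Matrix.diagonal_mul_diagonal, ← Matrix.diagonal_one]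
  congr 1
  funext x
  split_ifs <;> norm_num

theorem signGate_star {n : ℕ} (a : Fin n) (R : (Fin n → Fin 2) → Prop) :
    star (signGate a R) = signGate a R := by
  rw [signGate, Matrix.star_eq_conjTranspose, Matrix.diagonal_conjTranspose]
  congr 1
  funext x
  rw [Pi.star_apply]
  split_ifs <;> simp

theorem fin_two_cases (x y : Fin 2) : (x = 0 ∧ y = 0) ∨ (x = 0 ∧ y = 1) ∨ (x = 1 ∧ y = 0) ∨
    (x = 1 ∧ y = 1) := by
  revert x y
  decide

/-- The rotation is inverted by conjugation with the sign flip, so the commutator of the two is the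
square of the rotation where both controls hold, and trivial elsewhere. -/
theorem rotGate_commutator {n : ℕ} {a b : Fin n} {Q R : (Fin n → Fin 2) → Prop}
    (hQ : ∀ x, Q (swapBits a b x) ↔ Q x) (hR : ∀ x, R (swapBits a b x) ↔ R x) {c : ℝ} {z : ℂ}
    (hcz : (c : ℂ) ^ 2 + z * conj z = 1) :
    rotGate a b Q c z * (signGate a R * star (rotGate a b Q c z) * signGate a R) =
      rotGate a b (fun x => Q x ∧ R x) (2 * c ^ 2 - 1) (2 * c * z) := by
  rw [rotGate, signGate, diagonal_eq_pairGate (swapBits a b), pairGate_star swapBits_swapBits,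
    pairGate_mul swapBits_swapBits, pairGate_mul swapBits_swapBits, pairGate_mul swapBits_swapBits,
    rotGate]
  have h22 : conj (2 : ℂ) = 2 := map_ofNat _ 2
  congr 1
  · funext x
    rcases fin_two_cases (x a) (x b) with h | h | h | h <;> obtain ⟨h1, h2⟩ := h <;>
      by_cases hq : Q x <;> by_cases hr : R x <;> simp [h1, h2, hq, hr, hQ, hR, swapBits_left,
        swapBits_right, swapBits_swapBits] <;>
      first
      | linear_combination hcz
      | linear_combination -hcz
  · funext x
    rcases fin_two_cases (x a) (x b) with h | h | h | h <;> obtain ⟨h1, h2⟩ := h <;>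
      by_cases hq : Q x <;> by_cases hr : R x <;> simp [h1, h2, hq, hr, hQ, hR, swapBits_left,
        swapBits_right, swapBits_swapBits, h22] <;>
      ring

theorem IsCircuit.of_isLocal {n k : ℕ} {V : QubitOp n} (hs : IsSymmetric V) (hl : IsLocal k V)
    (hu : V * Star.star V = 1) : IsCircuit k V :=
  ⟨⟨V, Matrix.mem_unitaryGroup_iff.2 hu⟩, Subgroup.subset_closure ⟨hs, hl⟩, rfl⟩

theorem isCircuit_signGate {n k : ℕ} (hk : 2 ≤ k) (a e : Fin n) (r : Fin 2 → Prop) :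
    IsCircuit k (signGate a fun x => r (x e)) := by
  refine .of_isLocal (isSymmetric_diagonal _) (isLocal_diagonal {a, e} (card_le_two.trans hk) _ ?_) ?_
  · intro x y h
    beta_reduce
    rw [h a (by simp), h e (by simp)]
  · rw [signGate_star, signGate_mul_self]

theorem rotGate_mul_star {n : ℕ} {a b : Fin n} {Q : (Fin n → Fin 2) → Prop}
    (hQ : ∀ x, Q (swapBits a b x) ↔ Q x) {c : ℝ} {z : ℂ} (hcz : (c : ℂ) ^ 2 + z * conj z = 1) :
    rotGate a b Q c z * star (rotGate a b Q c z) = 1 := by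
  rw [rotGate, pairGate_star swapBits_swapBits, pairGate_mul swapBits_swapBits,
    ← Matrix.diagonal_one, diagonal_eq_pairGate (swapBits a b)]
  congr 1
  · funext x
    rcases fin_two_cases (x a) (x b) with h | h | h | h <;> obtain ⟨h1, h2⟩ := h <;>
      by_cases hq : Q x <;> simp [h1, h2, hq, swapBits_left, swapBits_right,
        swapBits_swapBits] <;>
      linear_combination hcz
  · funext x
    rcases fin_two_cases (x a) (x b) with h | h | h | h <;> obtain ⟨h1, h2⟩ := h <;>
      by_cases hq : Q x <;> simp [h1, h2, hq, hQ, swapBits_left, swapBits_right] <;>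
      ring

theorem isSymmetric_rotGate {n : ℕ} (a b : Fin n) (Q : (Fin n → Fin 2) → Prop) (c : ℝ) (z : ℂ) :
    IsSymmetric (rotGate a b Q c z) := by
  refine isSymmetric_iff.2 fun x y hxy => ?_
  have h1 : y ≠ x := fun h => hxy (by rw [h])
  have h2 : y ≠ swapBits a b x := fun h => hxy (by rw [h, hammingNorm_swapBits])
  simp [rotGate, pairGate, h1, h2]

theorem isCircuit_rotGate_true {n k : ℕ} (hk : 2 ≤ k) {a b : Fin n} {c : ℝ} {z : ℂ}
    (hcz : (c : ℂ) ^ 2 + z * conj z = 1) : IsCircuit k (rotGate a b (fun _ => True) c z) := by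
  refine .of_isLocal (isSymmetric_rotGate _ _ _ _ _)
    (isLocal_of_restrict {a, b} (card_le_two.trans hk) _ ?_ ?_) (rotGate_mul_star (by simp) hcz)
  · rintro x y ⟨i, hi, hxy⟩
    simp only [mem_insert, mem_singleton, not_or] at hi
    have h1 : y ≠ x := fun h => hxy (by rw [h])
    have h2 : y ≠ swapBits a b x := fun h => hxy (by rw [h, swapBits_of_ne x hi.1 hi.2])
    simp [rotGate, pairGate, h1, h2]
  · intro x y x' y' hx hy hxy hxy'
    have key : ∀ u v : Fin n → Fin 2, (∀ i, i ∉ ({a, b} : Finset (Fin n)) → u i = v i) →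
        (v = u ↔ v a = u a ∧ v b = u b) := by
      intro u v huv
      refine ⟨fun h => by simp [h], fun h => ?_⟩
      funext i
      by_cases hi : i ∈ ({a, b} : Finset (Fin n))
      · rcases mem_insert.1 hi with rfl | hi
        · exact h.1
        · rw [mem_singleton.1 hi]
          exact h.2
      · exact (huv i hi).symm
    have hswap : ∀ u v : Fin n → Fin 2, (∀ i, i ∉ ({a, b} : Finset (Fin n)) → u i = v i) →
        ∀ i, i ∉ ({a, b} : Finset (Fin n)) → swapBits a b u i = v i := by
      intro u v huv i hi
      rw [← huv i hi]
      simp only [mem_insert, mem_singleton, not_or] at hi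
      exact swapBits_of_ne u hi.1 hi.2
    simp only [rotGate, pairGate, Matrix.of_apply, key x y hxy, key x' y' hxy',
      key _ y (hswap x y hxy), key _ y' (hswap x' y' hxy'), swapBits_left, swapBits_right,
      hx a (by simp), hx b (by simp), hy a (by simp), hy b (by simp)]
    congr!

/-- The square root of a rotation, by the half-angle formulas. -/
theorem exists_sqrt_rotation {c : ℝ} {z : ℂ} (hcz : (c : ℂ) ^ 2 + z * conj z = 1) :
    ∃ (c' : ℝ) (z' : ℂ), (c' : ℂ) ^ 2 + z' * conj z' = 1 ∧ 2 * c' ^ 2 - 1 = c ∧ 2 * c' * z' = z := by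
  have hreal : c ^ 2 + Complex.normSq z = 1 := by
    rw [Complex.mul_conj] at hcz
    exact_mod_cast hcz
  have hz0 := Complex.normSq_nonneg z
  by_cases hc : c = -1
  · refine ⟨0, 1, by simp, by rw [hc]; norm_num, ?_⟩
    have : Complex.normSq z = 0 := by rw [hc] at hreal; linarith
    rw [Complex.normSq_eq_zero.1 this]
    simp
  · have hc1 : 0 < 1 + c := by
      have h1 : -1 ≤ c := by nlinarith
      have h2 : -1 < c := lt_of_le_of_ne h1 (Ne.symm hc)
      linarith
    set r := Real.sqrt ((1 + c) / 2) with hr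
    have hr2 : r ^ 2 = (1 + c) / 2 := Real.sq_sqrt (by linarith)
    have hr0 : 0 < r := Real.sqrt_pos.2 (by linarith)
    have hrc : (r : ℂ) ≠ 0 := by exact_mod_cast hr0.ne'
    refine ⟨r, z / (2 * r), ?_, by rw [hr2]; ring, by field_simp⟩
    have h22 : conj (2 : ℂ) = 2 := map_ofNat _ 2
    have hr2' : (r : ℂ) ^ 2 = (1 + c) / 2 := by exact_mod_cast hr2
    have hc1' : (1 + c : ℂ) ≠ 0 := by exact_mod_cast hc1.ne'
    have h1 : z / (2 * r) * conj (z / (2 * r)) = (1 - (c : ℂ) ^ 2) / (2 * (1 + c)) := by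
      rw [map_div₀, map_mul, h22, Complex.conj_ofReal, div_mul_div_comm,
        show z * conj z = 1 - (c : ℂ) ^ 2 by linear_combination hcz,
        show (2 * (r : ℂ)) * (2 * r) = 2 * (1 + c) by linear_combination 4 * hr2']
    rw [h1, hr2']
    field_simp
    ring

/-- Each commutator with a two-qubit controlled sign flip adds one control. -/
theorem isCircuit_rotGate_controlled {n k : ℕ} (hk : 2 ≤ k) {a b : Fin n} (v : Fin n → Fin 2)
    (C : Finset (Fin n)) (ha : a ∉ C) (hb : b ∉ C) {c : ℝ} {z : ℂ}
    (hcz : (c : ℂ) ^ 2 + z * conj z = 1) :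
    IsCircuit k (rotGate a b (fun x => ∀ e ∈ C, x e = v e) c z) := by
  induction C using Finset.induction_on generalizing c z with
  | empty => simpa using isCircuit_rotGate_true hk hcz
  | insert e C heC ih =>
    simp only [mem_insert, not_or] at ha hb
    obtain ⟨c', z', h1, h2, h3⟩ := exists_sqrt_rotation hcz
    have hU := ih ha.2 hb.2 h1
    have hD : IsCircuit k (signGate a fun x : Fin n → Fin 2 => x e = v e) :=
      isCircuit_signGate hk a e (fun u => u = v e)
    have h := (hU.commutator hD (signGate_mul_self _ _)).1
    rw [rotGate_commutator, h2, h3] at h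
    · convert h using 2
      funext x
      simp [and_comm]
    · intro x
      refine forall₂_congr fun i hi => ?_
      rw [swapBits_of_ne x (fun h => ha.2 (by rwa [← h])) (fun h => hb.2 (by rwa [← h]))]
    · intro x
      rw [swapBits_of_ne x (Ne.symm ha.1) (Ne.symm hb.1)]
    · exact h1

/-! ### Two-level rotations -/

/-- The rotation by `c`, `z` in the plane of the basis vectors `s` and `t`. -/
noncomputable def twoLevel {X : Type*} [DecidableEq X] (s t : X) (c : ℝ) (z : ℂ) : Matrix X X ℂ :=
  pairGate (Equiv.swap s t) (fun x => if x = s ∨ x = t then (c : ℂ) else 1)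
    (fun x => if x = s then -conj z else if x = t then z else 0)

section twoLevel

variable {X : Type*} [Fintype X] [DecidableEq X] {s t : X}

theorem twoLevel_mulVec_left (c : ℝ) (z : ℂ) (v : X → ℂ) :
    (twoLevel s t c z *ᵥ v) s = c * v s - conj z * v t := by
  rw [twoLevel, pairGate_mulVec]
  simp [sub_eq_add_neg]

theorem twoLevel_mulVec_right (h : s ≠ t) (c : ℝ) (z : ℂ) (v : X → ℂ) :
    (twoLevel s t c z *ᵥ v) t = c * v t + z * v s := by
  rw [twoLevel, pairGate_mulVec]
  simp [h.symm]

theorem twoLevel_mulVec_of_ne (c : ℝ) (z : ℂ) (v : X → ℂ) {x : X} (hs : x ≠ s) (ht : x ≠ t) :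
    (twoLevel s t c z *ᵥ v) x = v x := by
  rw [twoLevel, pairGate_mulVec]
  simp [hs, ht]

theorem twoLevel_swap (h : s ≠ t) (c : ℝ) (z : ℂ) :
    twoLevel t s c z = twoLevel s t c (-conj z) := by
  refine eq_of_mulVec_eq fun v x => ?_
  by_cases hs : x = s
  · subst hs
    rw [twoLevel_mulVec_left, twoLevel_mulVec_right h.symm]
    simp
  by_cases ht : x = t
  · subst ht
    rw [twoLevel_mulVec_left, twoLevel_mulVec_right h]
    simp
    ring
  · rw [twoLevel_mulVec_of_ne _ _ _ hs ht, twoLevel_mulVec_of_ne _ _ _ ht hs]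

/-- Conjugation by the quarter turn from `t` to `r` moves the plane of `s, t` to that of `s, r`. -/
theorem twoLevel_conj {r : X} (hst : s ≠ t) (htr : t ≠ r) (hsr : s ≠ r) (c : ℝ) (z : ℂ) :
    twoLevel t r 0 1 * twoLevel s t c z = twoLevel s r c z * twoLevel t r 0 1 := by
  refine eq_of_mulVec_eq fun v x => ?_
  rw [← Matrix.mulVec_mulVec, ← Matrix.mulVec_mulVec]
  by_cases hs : x = s
  · subst hs
    rw [twoLevel_mulVec_of_ne _ _ _ hst hsr, twoLevel_mulVec_left, twoLevel_mulVec_left,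
      twoLevel_mulVec_of_ne _ _ _ hst hsr, twoLevel_mulVec_right htr]
    simp
  by_cases ht : x = t
  · subst ht
    rw [twoLevel_mulVec_left, twoLevel_mulVec_of_ne _ _ _ hs htr, twoLevel_mulVec_left,
      twoLevel_mulVec_of_ne _ _ _ hsr.symm htr.symm]
    simp
  by_cases hr : x = r
  · subst hr
    rw [twoLevel_mulVec_right htr, twoLevel_mulVec_right hsr, twoLevel_mulVec_right hst,
      twoLevel_mulVec_right htr, twoLevel_mulVec_of_ne _ _ _ hs ht,
      twoLevel_mulVec_of_ne _ _ _ hst hsr]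
    simp
  · rw [twoLevel_mulVec_of_ne _ _ _ ht hr, twoLevel_mulVec_of_ne _ _ _ hs ht,
      twoLevel_mulVec_of_ne _ _ _ hs hr, twoLevel_mulVec_of_ne _ _ _ ht hr]

end twoLevel

/-- All rotations in the plane of `s` and `t` are special circuits. -/
def IsLinked {n : ℕ} (k : ℕ) (s t : Fin n → Fin 2) : Prop :=
  ∀ (c : ℝ) (z : ℂ), (c : ℂ) ^ 2 + z * conj z = 1 → IsSpecialCircuit k (twoLevel s t c z)

theorem rotGate_eq_twoLevel {n : ℕ} {a b : Fin n} (v : Fin n → Fin 2) (ha : v a = 1) (hb : v b = 0)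
    (c : ℝ) (z : ℂ) :
    rotGate a b (fun x => ∀ e ∈ univ \ ({a, b} : Finset (Fin n)), x e = v e) c z =
      twoLevel (swapBits a b v) v c z := by
  have hab : a ≠ b := fun h => by rw [h, hb] at ha; exact absurd ha (by decide)
  have hne : swapBits a b v ≠ v := fun h => by
    have := congrFun h a
    rw [swapBits_left, ha, hb] at this
    exact absurd this (by decide)
  have hv : ∀ e ∈ univ \ ({a, b} : Finset (Fin n)), v e = v e := fun _ _ => rfl
  have hv' : ∀ e ∈ univ \ ({a, b} : Finset (Fin n)), swapBits a b v e = v e := fun e he => by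
    simp only [mem_sdiff, mem_univ, true_and, mem_insert, mem_singleton, not_or] at he
    exact swapBits_of_ne v he.1 he.2
  refine eq_of_mulVec_eq fun u x => ?_
  by_cases hxv : x = v
  · subst hxv
    rw [twoLevel_mulVec_right hne, rotGate, pairGate_mulVec, if_pos ⟨hv, by rw [ha, hb]; decide⟩,
      if_pos ⟨hv, by rw [ha, hb]; decide⟩, if_pos ha]
  by_cases hxv' : x = swapBits a b v
  · subst hxv'
    have h1 : swapBits a b v a ≠ swapBits a b v b := by
      rw [swapBits_left, swapBits_right, ha, hb]
      decide
    have h2 : swapBits a b v a ≠ 1 := by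
      rw [swapBits_left, hb]
      decide
    rw [twoLevel_mulVec_left, rotGate, pairGate_mulVec, if_pos ⟨hv', h1⟩, if_pos ⟨hv', h1⟩,
      if_neg h2, swapBits_swapBits]
    ring
  · have hQ : ¬ ((∀ e ∈ univ \ ({a, b} : Finset (Fin n)), x e = v e) ∧ x a ≠ x b) := by
      rintro ⟨h1, h2⟩
      have key : ∀ y : Fin n → Fin 2, (∀ e ∈ univ \ ({a, b} : Finset (Fin n)), y e = v e) →
          x a = y a → x b = y b → x = y := by
        intro y hy hya hyb
        funext i
        by_cases hia : i = a
        · rw [hia, hya]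
        by_cases hib : i = b
        · rw [hib, hyb]
        · have hi : i ∈ univ \ ({a, b} : Finset (Fin n)) := by simp [hia, hib]
          rw [h1 i hi, hy i hi]
      rcases fin_two_cases (x a) (x b) with h | h | h | h <;> obtain ⟨h3, h4⟩ := h
      · exact h2 (by rw [h3, h4])
      · exact hxv' (key _ hv' (by rw [swapBits_left, h3, hb]) (by rw [swapBits_right, h4, ha]))
      · exact hxv (key _ hv (by rw [h3, ha]) (by rw [h4, hb]))
      · exact h2 (by rw [h3, h4])
    rw [twoLevel_mulVec_of_ne _ _ _ hxv' hxv, rotGate, pairGate_mulVec, if_neg hQ, if_neg hQ]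
    ring

/-- The last commutator, with the uncontrolled sign flip, only serves to make the determinants
trivial. -/
theorem isLinked_swapBits {n k : ℕ} (hk : 2 ≤ k) {a b : Fin n} (v : Fin n → Fin 2) (ha : v a = 1)
    (hb : v b = 0) : IsLinked k (swapBits a b v) v := by
  intro c z hcz
  obtain ⟨c', z', h1, h2, h3⟩ := exists_sqrt_rotation hcz
  have hU := isCircuit_rotGate_controlled hk (a := a) (b := b) v
    (univ \ ({a, b} : Finset (Fin n))) (by simp) (by simp) h1
  have hD : IsCircuit k (signGate a fun _ : Fin n → Fin 2 => True) :=
    isCircuit_signGate hk a a (fun _ => True)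
  have h := hU.commutator hD (signGate_mul_self _ _)
  rw [rotGate_commutator, h2, h3] at h
  · simp only [and_true] at h
    rwa [rotGate_eq_twoLevel v ha hb] at h
  · intro x
    refine forall₂_congr fun i hi => ?_
    simp only [mem_sdiff, mem_univ, true_and, mem_insert, mem_singleton, not_or] at hi
    rw [swapBits_of_ne x hi.1 hi.2]
  · simp
  · exact h1

theorem IsLinked.symm {n k : ℕ} {s t : Fin n → Fin 2} (hst : s ≠ t) (h : IsLinked k s t) :
    IsLinked k t s := by
  intro c z hcz
  rw [twoLevel_swap hst]
  refine h c _ ?_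
  simp only [map_neg, Complex.conj_conj]
  linear_combination hcz

theorem IsLinked.trans {n k : ℕ} {s t r : Fin n → Fin 2} (hst : s ≠ t) (htr : t ≠ r) (hsr : s ≠ r)
    (h1 : IsLinked k s t) (h2 : IsLinked k t r) : IsLinked k s r := by
  intro c z hcz
  have hM := h2 0 1 (by simp)
  have h := (hM.mul (h1 c z hcz)).mul hM.star
  rwa [twoLevel_conj hst htr hsr, Matrix.mul_assoc, hM.1.mul_star_self, Matrix.mul_one] at h

theorem exists_one_zero_of_hammingNorm_eq {n : ℕ} {s t : Fin n → Fin 2} (hst : s ≠ t)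
    (h : hammingNorm s = hammingNorm t) : ∃ a, s a = 1 ∧ t a = 0 := by
  by_contra! hcon
  apply hst
  have hsub : (univ.filter fun i => s i ≠ 0) ⊆ univ.filter fun i => t i ≠ 0 := by
    intro i hi
    have hi' := (mem_filter.1 hi).2
    refine mem_filter.2 ⟨mem_univ _, hcon i ?_⟩
    rcases fin_two_cases (s i) 0 with h | h | h | h <;> simp_all
  have heq := eq_of_subset_of_card_le hsub (le_of_eq h.symm)
  funext i
  have hi : s i ≠ 0 ↔ t i ≠ 0 := by simpa using Finset.ext_iff.1 heq i
  rcases fin_two_cases (s i) (t i) with h | h | h | h <;> simp_all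

/-- Two states of equal weight are connected by a chain of exchanges of two qubits. -/
theorem isLinked_of_hammingNorm_eq {n k : ℕ} (hk : 2 ≤ k) {s t : Fin n → Fin 2} (hst : s ≠ t)
    (h : hammingNorm s = hammingNorm t) : IsLinked k s t := by
  induction hd : hammingDist s t using Nat.strong_induction_on generalizing s with
  | _ d ih =>
    obtain ⟨a, ha, ha'⟩ := exists_one_zero_of_hammingNorm_eq hst h
    obtain ⟨b, hb', hb⟩ := exists_one_zero_of_hammingNorm_eq hst.symm h.symm
    set s' := swapBits a b s with hs'
    have hne : s' ≠ s := fun h => by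
      have := congrFun h a
      rw [hs', swapBits_left, ha, hb] at this
      exact absurd this (by decide)
    have hlink : IsLinked k s s' := (isLinked_swapBits hk s ha hb).symm hne
    by_cases hs't : s' = t
    · rwa [← hs't]
    have hdist : hammingDist s' t < d := by
      rw [← hd]
      refine card_lt_card ⟨?_, ?_⟩
      · intro i hi
        have hi' := (mem_filter.1 hi).2
        refine mem_filter.2 ⟨mem_univ _, ?_⟩
        by_cases hia : i = a
        · rw [hia, hs', swapBits_left, hb, ha'] at hi'
          exact absurd rfl hi'
        by_cases hib : i = b
        · rw [hib, hs', swapBits_right, ha, hb'] at hi'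
          exact absurd rfl hi'
        · rwa [hs', swapBits_of_ne s hia hib] at hi'
      · intro hsub
        have : a ∈ univ.filter fun i => s' i ≠ t i :=
          hsub (mem_filter.2 ⟨mem_univ _, by simp [ha, ha']⟩)
        have := (mem_filter.1 this).2
        rw [hs', swapBits_left, hb, ha'] at this
        exact this rfl
    exact hlink.trans hne.symm hs't hst
      (ih _ hdist hs't ((hammingNorm_swapBits s).trans h) rfl)

/-! ### Givens reduction -/

/-- `V` fixes the basis vectors outside `s`. -/
def FixesOutside {X : Type*} [DecidableEq X] (V : Matrix X X ℂ) (s : Finset X) : Prop :=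
  ∀ x ∉ s, ∀ y, V y x = (1 : Matrix X X ℂ) y x

theorem FixesOutside.mul {X : Type*} [Fintype X] [DecidableEq X] {V W : Matrix X X ℂ} {s : Finset X}
    (hV : FixesOutside V s) (hW : FixesOutside W s) : FixesOutside (V * W) s := by
  intro x hx y
  rw [Matrix.mul_apply, sum_congr rfl fun z _ => by rw [hW x hx z], ← Matrix.mul_apply,
    Matrix.mul_one, hV x hx y]

theorem FixesOutside.mono {X : Type*} [DecidableEq X] {V : Matrix X X ℂ} {s t : Finset X}
    (hV : FixesOutside V s) (hst : s ⊆ t) : FixesOutside V t :=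
  fun x hx y => hV x (fun h => hx (hst h)) y

theorem fixesOutside_one {X : Type*} [DecidableEq X] (s : Finset X) :
    FixesOutside (1 : Matrix X X ℂ) s := fun _ _ _ => rfl

theorem fixesOutside_twoLevel {X : Type*} [Fintype X] [DecidableEq X] {a b : X} (hab : a ≠ b)
    (c : ℝ) (z : ℂ) {s : Finset X} (ha : a ∈ s) (hb : b ∈ s) :
    FixesOutside (twoLevel a b c z) s := by
  intro x hx y
  have hxa : a ≠ x := fun h => hx (by rwa [← h])
  have hxb : b ≠ x := fun h => hx (by rwa [← h])
  have h1 : twoLevel a b c z y x = (twoLevel a b c z *ᵥ Pi.single x 1) y := by simp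
  rw [h1, Matrix.one_apply]
  by_cases hya : y = a
  · rw [hya, twoLevel_mulVec_left]
    simp [hxa, hxb]
  by_cases hyb : y = b
  · rw [hyb, twoLevel_mulVec_right hab]
    simp [hxa, hxb]
  · rw [twoLevel_mulVec_of_ne _ _ _ hya hyb, Pi.single_apply]

theorem exists_rotation_annihilating (α β : ℂ) :
    ∃ (c : ℝ) (z : ℂ), (c : ℂ) ^ 2 + z * conj z = 1 ∧ c * β + z * α = 0 := by
  by_cases hα : α = 0
  · exact ⟨0, 1, by simp, by simp [hα]⟩
  set r := Real.sqrt (Complex.normSq α + Complex.normSq β) with hr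
  have hα' : 0 < Complex.normSq α := Complex.normSq_pos.2 hα
  have hβ' := Complex.normSq_nonneg β
  have hr2 : r ^ 2 = Complex.normSq α + Complex.normSq β := Real.sq_sqrt (by linarith)
  have hr0 : 0 < r := Real.sqrt_pos.2 (by linarith)
  have hn : ‖α‖ ^ 2 = Complex.normSq α := (Complex.normSq_eq_norm_sq α).symm
  have hrc : (r : ℂ) ≠ 0 := by exact_mod_cast hr0.ne'
  refine ⟨‖α‖ / r, -(β * (‖α‖ / r : ℝ)) / α, ?_, ?_⟩
  · have h1 : (-(β * ((‖α‖ / r : ℝ) : ℂ)) / α) * conj (-(β * ((‖α‖ / r : ℝ) : ℂ)) / α) =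
        ((Complex.normSq β / r ^ 2 : ℝ) : ℂ) := by
      rw [Complex.mul_conj]
      congr 1
      rw [Complex.normSq_div, Complex.normSq_neg, Complex.normSq_mul, Complex.normSq_ofReal]
      have hα0 := hα'.ne'
      field_simp
      rw [hn]
    rw [h1]
    have h2 : (‖α‖ / r) ^ 2 + Complex.normSq β / r ^ 2 = 1 := by
      rw [div_pow, hn, ← add_div, ← hr2, div_self (by positivity)]
    exact_mod_cast h2
  · field_simp
    ring

/-- Rotations in the planes of `a` and `b`, for `b ∈ r`, turn a vector supported on `insert a r`
into the direction of `a`. -/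
theorem exists_isSpecialCircuit_mulVec {n k : ℕ} (hk : 2 ≤ k) {a : Fin n → Fin 2}
    (r : Finset (Fin n → Fin 2)) (har : a ∉ r) (hr : ∀ b ∈ r, hammingNorm b = hammingNorm a)
    (v : (Fin n → Fin 2) → ℂ) (hv : ∀ x, x ≠ a → x ∉ r → v x = 0) :
    ∃ H : QubitOp n, IsSpecialCircuit k H ∧ FixesOutside H (insert a r) ∧
      ∀ x, x ≠ a → (H *ᵥ v) x = 0 := by
  induction r using Finset.induction_on generalizing v with
  | empty => exact ⟨1, .one, fixesOutside_one _, fun x hx => by simpa using hv x hx⟩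
  | insert b r hbr ih =>
    simp only [mem_insert, not_or] at har
    have hlink := isLinked_of_hammingNorm_eq hk har.1 (hr b (mem_insert_self _ _)).symm
    obtain ⟨c, z, hcz, h0⟩ := exists_rotation_annihilating (v a) (v b)
    obtain ⟨H, hH, hHf, hHv⟩ := ih har.2 (fun b' hb' => hr b' (mem_insert_of_mem hb'))
      (twoLevel a b c z *ᵥ v) (by
        intro x hxa hxr
        by_cases hxb : x = b
        · rw [hxb, twoLevel_mulVec_right har.1, h0]
        · rw [twoLevel_mulVec_of_ne _ _ _ hxa hxb]
          exact hv x hxa (by simp [hxb, hxr]))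
    refine ⟨H * twoLevel a b c z, hH.mul (hlink c z hcz), (hHf.mono ?_).mul
      (fixesOutside_twoLevel har.1 c z (by simp) (by simp)), fun x hx => ?_⟩
    · exact insert_subset_insert _ (subset_insert _ _)
    · rw [← Matrix.mulVec_mulVec]
      exact hHv x hx

/-- Givens rotations turn the column of `a` into a multiple of the basis vector at `a`; the remaining
phase is moved to another vector of the sector or, if there is none left, equals the determinant.
This removes `a` from `s`. -/
theorem isCircuit_of_fixesOutside {n k : ℕ} (hk : 2 ≤ k) (s : Finset (Fin n → Fin 2))
    (V : QubitOp n) (hu : star V * V = 1) (hs : IsSymmetric V) (hdet : ∀ w, sectorDet w V = 1)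
    (hfix : FixesOutside V s) : IsCircuit k V := by
  induction s using Finset.induction_on generalizing V with
  | empty =>
    have : V = 1 := by
      ext y x
      exact hfix x (by simp) y
    rw [this]
    exact IsSpecialCircuit.one.1
  | insert a s has ih =>
    have hcol : ∀ y, y ≠ a → y ∉ s → V y a = 0 := by
      intro y hya hys
      have h := congrFun (congrFun hu y) a
      rw [Matrix.mul_apply, Matrix.one_apply_ne hya] at h
      rw [← h, sum_eq_single y]
      · rw [Matrix.star_apply, hfix y (by simp [hya, hys]), Matrix.one_apply_eq, star_one, one_mul]
      · intro z _ hz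
        rw [Matrix.star_apply, hfix y (by simp [hya, hys]), Matrix.one_apply_ne hz, star_zero,
          zero_mul]
      · simp
    set r := s.filter fun b => hammingNorm b = hammingNorm a with hr
    obtain ⟨H, hH, hHf, hHv⟩ := exists_isSpecialCircuit_mulVec hk (a := a) r
      (fun h => has (mem_filter.1 h).1) (fun b hb => (mem_filter.1 hb).2) (fun x => V x a) (by
        intro x hxa hxr
        by_cases hw : hammingNorm x = hammingNorm a
        · exact hcol x hxa fun h => hxr (mem_filter.2 ⟨h, hw⟩)
        · exact isSymmetric_iff.1 hs _ _ hw)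
    set W := H * V with hW
    have hWu : star W * W = 1 := by
      rw [hW, star_mul, Matrix.mul_assoc, ← Matrix.mul_assoc (star H), hH.1.star_mul_self,
        Matrix.one_mul, hu]
    have hWs : IsSymmetric W := fun θ => by
      rw [hW, Matrix.mul_assoc, hs θ, ← Matrix.mul_assoc, hH.1.isSymmetric θ, Matrix.mul_assoc]
    have hWdet : ∀ w, sectorDet w W = 1 := fun w => by
      rw [hW, sectorDet_mul hH.1.isSymmetric, hH.2, hdet, one_mul]
    have hWfix : FixesOutside W (insert a s) :=
      (hHf.mono (insert_subset_insert _ (filter_subset _ _))).mul hfix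
    have hWa : ∀ x, x ≠ a → W x a = 0 := fun x hx => hHv x hx
    obtain ⟨T, hT, hTf, hTa⟩ : ∃ T : QubitOp n, IsSpecialCircuit k T ∧
        FixesOutside T (insert a s) ∧ ∀ y, (T * W) y a = (1 : QubitOp n) y a := by
      obtain hre | ⟨b, hb⟩ := r.eq_empty_or_nonempty
      · refine ⟨1, .one, fixesOutside_one _, fun y => ?_⟩
        rw [Matrix.one_mul]
        by_cases hya : y = a
        · -- `a` is the only vector of its sector that is not fixed, so `W a a` is the determinant
          have hd := hWdet (hammingNorm a)
          have hdiag : W.submatrix (Subtype.val : {x : Fin n → Fin 2 // hammingNorm x = hammingNorm a} → _)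
              Subtype.val = Matrix.diagonal fun x => if x.1 = a then W a a else 1 := by
            ext x y
            rw [Matrix.submatrix_apply, Matrix.diagonal_apply]
            by_cases hy : y.1 = a
            · rw [hy]
              by_cases hxy : x = y
              · subst hxy
                rw [if_pos rfl, if_pos hy, hy]
              · rw [if_neg hxy, hWa _ fun h => hxy (Subtype.ext (by rw [h, hy]))]
            · have hys : y.1 ∉ s := fun h => by
                have : y.1 ∈ r := mem_filter.2 ⟨h, y.2⟩
                rw [hre] at this
                exact absurd this (by simp)
              rw [hWfix y.1 (by simp [hy, hys]), Matrix.one_apply]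
              by_cases hxy : x = y
              · subst hxy
                simp [hy]
              · rw [if_neg hxy, if_neg fun h => hxy (Subtype.ext h)]
          rw [sectorDet, hdiag, Matrix.det_diagonal, prod_eq_single ⟨a, rfl⟩, if_pos rfl] at hd
          · rw [hya, hd, Matrix.one_apply_eq]
          · intro x _ hx
            rw [if_neg fun h => hx (Subtype.ext h)]
          · simp
        · rw [hWa y hya, Matrix.one_apply_ne hya]
      · obtain ⟨hbs, hbw⟩ := mem_filter.1 hb
        have hab : a ≠ b := fun h => has (by rwa [h])
        have hlink := isLinked_of_hammingNorm_eq hk hab hbw.symm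
        have hnorm : conj (W a a) * W a a = 1 := by
          have h := congrFun (congrFun hWu a) a
          rw [Matrix.mul_apply, Matrix.one_apply_eq, sum_eq_single a] at h
          · exact h
          · intro z _ hz
            rw [hWa z hz, mul_zero]
          · simp
        -- two quarter turns with different phases act on `a` as multiplication by `conj (W a a)`
        refine ⟨twoLevel a b 0 (-1) * twoLevel a b 0 (conj (W a a)),
          (hlink 0 (-1) (by simp)).mul (hlink 0 _ (by
            rw [Complex.conj_conj, hnorm]
            simp)),
          (fixesOutside_twoLevel hab _ _ (by simp) (by simp [hbs])).mul
            (fixesOutside_twoLevel hab _ _ (by simp) (by simp [hbs])), fun y => ?_⟩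
        have h1 : (twoLevel a b 0 (-1) * twoLevel a b 0 (conj (W a a)) * W) y a =
            (twoLevel a b 0 (-1) *ᵥ (twoLevel a b 0 (conj (W a a)) *ᵥ fun x => W x a)) y := by
          rw [Matrix.mulVec_mulVec]
          rfl
        rw [h1]
        by_cases hya : y = a
        · rw [hya, twoLevel_mulVec_left, twoLevel_mulVec_right hab, twoLevel_mulVec_left,
            Matrix.one_apply_eq]
          simpa using hnorm
        rw [Matrix.one_apply_ne hya]
        by_cases hyb : y = b
        · rw [hyb, twoLevel_mulVec_right hab, twoLevel_mulVec_left, twoLevel_mulVec_right hab,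
            hWa b hab.symm]
          simp
        · rw [twoLevel_mulVec_of_ne _ _ _ hya hyb, twoLevel_mulVec_of_ne _ _ _ hya hyb, hWa y hya]
    have hTW : IsCircuit k (T * W) := by
      refine ih (T * W) ?_ ?_ ?_ ?_
      · rw [star_mul, Matrix.mul_assoc, ← Matrix.mul_assoc (star T), hT.1.star_mul_self,
          Matrix.one_mul, hWu]
      · intro θ
        rw [Matrix.mul_assoc, hWs θ, ← Matrix.mul_assoc, hT.1.isSymmetric θ, Matrix.mul_assoc]
      · intro w
        rw [sectorDet_mul hT.1.isSymmetric, hT.2, hWdet, one_mul]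
      · intro x hx y
        by_cases hxa : x = a
        · rw [hxa, hTa]
        · exact hTf.mul hWfix x (by simp [hxa, hx]) y
    have hVeq : V = star H * (star T * (T * W)) := by
      rw [← Matrix.mul_assoc (star T), hT.1.star_mul_self, Matrix.one_mul, hW,
        ← Matrix.mul_assoc, hH.1.star_mul_self, Matrix.one_mul]
    rw [hVeq]
    exact hH.1.star.mul (hT.1.star.mul hTW)

/-- For `k ≥ 2` the `k`-local circuits contain the product of the special unitary groups of the
sectors. -/
theorem mem_circuitGroup_of_sectorDet_eq_one {n k : ℕ} (hk : 2 ≤ k) {V : QubitUnitary n}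
    (hV : V ∈ symmetricGroup n) (hdet : ∀ w, sectorDet w (V : QubitOp n) = 1) :
    V ∈ circuitGroup n k := by
  obtain ⟨U, hU, hUV⟩ := isCircuit_of_fixesOutside hk univ (V : QubitOp n)
    (Matrix.mem_unitaryGroup_iff'.1 V.2) hV hdet (fun x hx => absurd (mem_univ x) hx)
  rwa [← Subtype.ext hUV]

/-! ### The sector determinants of circuits -/

/-- The phase `ζ` on the states whose qubits `i < k` show `j` ones followed by zeros. -/
noncomputable def patternPhase (n k j : ℕ) (ζ : ℂ) : QubitOp n :=
  Matrix.diagonal fun x => if ∀ i : Fin n, (i : ℕ) < k → (x i = 1 ↔ (i : ℕ) < j) then ζ else 1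

theorem isCircuit_patternPhase {n k : ℕ} (j : ℕ) {ζ : ℂ} (hζ : ζ * star ζ = 1) :
    IsCircuit k (patternPhase n k j ζ) := by
  have hcard : #{i : Fin n | (i : ℕ) < k} ≤ k := by
    simp [Fin.card_filter_val_lt]
  refine .of_isLocal (isSymmetric_diagonal _) (isLocal_diagonal _ hcard _ ?_) ?_
  · intro x y h
    have : (∀ i : Fin n, (i : ℕ) < k → (x i = 1 ↔ (i : ℕ) < j)) ↔
        ∀ i : Fin n, (i : ℕ) < k → (y i = 1 ↔ (i : ℕ) < j) :=
      forall₂_congr fun i hi => by rw [h i (by simpa using hi)]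
    simp only [this]
  · rw [patternPhase, Matrix.star_eq_conjTranspose, Matrix.diagonal_conjTranspose,
      Matrix.diagonal_mul_diagonal, ← Matrix.diagonal_one]
    congr 1
    funext x
    rw [Pi.star_apply]
    split_ifs
    · exact hζ
    · simp

theorem sectorDet_patternPhase_of_lt {n k j w : ℕ} (hk : k ≤ n) (hj : j ≤ k) (ζ : ℂ) (hw : w < j) :
    sectorDet w (patternPhase n k j ζ) = 1 := by
  rw [patternPhase, sectorDet_diagonal]
  refine prod_eq_one fun x hx => if_neg fun h => ?_
  have hxw := (mem_filter.1 hx).2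
  have hsub : (univ.filter fun i : Fin n => (i : ℕ) < j) ⊆ univ.filter fun i => x i ≠ 0 := by
    intro i hi
    have hi' := (mem_filter.1 hi).2
    refine mem_filter.2 ⟨mem_univ _, ?_⟩
    rw [(h i (by omega)).2 hi']
    decide
  have hc := card_le_card hsub
  rw [Fin.card_filter_val_lt] at hc
  rw [hammingNorm] at hxw
  omega

theorem sectorDet_patternPhase_self {n k j : ℕ} (hk : k ≤ n) (hj : j ≤ k) (ζ : ℂ) :
    sectorDet j (patternPhase n k j ζ) = ζ := by
  rw [patternPhase, sectorDet_diagonal]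
  have hcard : #{i : Fin n | (i : ℕ) < j} = j := by
    rw [Fin.card_filter_val_lt]
    omega
  set x₀ : Fin n → Fin 2 := fun i => if (i : ℕ) < j then 1 else 0 with hx₀
  have hx₀w : hammingNorm x₀ = j := by
    rw [hammingNorm, ← hcard]
    congr 1
    ext i
    by_cases hi : (i : ℕ) < j <;> simp [hx₀, hi]
  have hx₀p : ∀ i : Fin n, (i : ℕ) < k → (x₀ i = 1 ↔ (i : ℕ) < j) := by
    intro i _
    by_cases hi : (i : ℕ) < j <;> simp [hx₀, hi]
  rw [prod_eq_single x₀, if_pos hx₀p]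
  · intro x hx hne
    refine if_neg fun h => hne ?_
    have hsub : (univ.filter fun i : Fin n => (i : ℕ) < j) ⊆ univ.filter fun i => x i ≠ 0 := by
      intro i hi
      have hi' := (mem_filter.1 hi).2
      refine mem_filter.2 ⟨mem_univ _, ?_⟩
      rw [(h i (by omega)).2 hi']
      decide
    have heq := eq_of_subset_of_card_le hsub (le_of_eq (by
      rw [hcard]
      exact (mem_filter.1 hx).2))
    funext i
    have hi : (i : ℕ) < j ↔ x i ≠ 0 := by simpa using Finset.ext_iff.1 heq i
    rcases fin_two_cases (x i) 0 with h | h | h | h <;> simp_all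
  · intro h
    exact absurd (mem_filter.2 ⟨mem_univ x₀, hx₀w⟩) h

/-- On `k` qubits, the phase on a single state of weight `j` changes the determinant of sector `j`
and none below it, so the determinants are adjusted in increasing order. -/
theorem exists_mem_circuitGroup_sectorDet_eq {n k : ℕ} (hk : k ≤ n) (z : ℕ → ℂ)
    (hz : ∀ w, z w * star (z w) = 1) :
    ∃ U ∈ circuitGroup n k, ∀ w ≤ k, sectorDet w (U : QubitOp n) = z w := by
  suffices h : ∀ m ≤ k + 1, ∃ U ∈ circuitGroup n k, ∀ w < m, sectorDet w (U : QubitOp n) = z w by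
    obtain ⟨U, hU, h⟩ := h (k + 1) le_rfl
    exact ⟨U, hU, fun w hw => h w (by omega)⟩
  intro m
  induction m with
  | zero => exact fun _ => ⟨1, one_mem _, fun w hw => by omega⟩
  | succ m ih =>
    intro hm
    obtain ⟨U, hU, h⟩ := ih (by omega)
    have hUG := circuitGroup_le_symmetricGroup n k hU
    have hd := sectorDet_mul_star hUG m
    obtain ⟨D, hD, hDeq⟩ := isCircuit_patternPhase (n := n) (k := k) m
      (ζ := z m * star (sectorDet m (U : QubitOp n))) (by
        rw [star_mul', star_star]
        linear_combination (z m * star (z m)) * hd + hz m)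
    refine ⟨U * D, mul_mem hU hD, fun w hw => ?_⟩
    rw [Submonoid.coe_mul, sectorDet_mul hUG, hDeq]
    obtain rfl | hlt : w = m ∨ w < m := by omega
    · rw [sectorDet_patternPhase_self hk (by omega)]
      linear_combination z w * hd
    · rw [sectorDet_patternPhase_of_lt hk (by omega) _ hlt, mul_one, h w hlt]

/-- The values of a relation on the weights above `k` can be prescribed, because the remaining
system of equations is unitriangular over the integers. -/
theorem exists_isDetRelation (n k : ℕ) (c : ℕ → ℤ) :
    ∃ x : ℕ → ℤ, IsDetRelation n k x ∧ ∀ w, k < w → x w = c w := by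
  suffices h : ∀ m ≤ k + 1, ∃ x : ℕ → ℤ, (∀ w, k < w → x w = c w) ∧ ∀ j ≤ k, k + 1 - m ≤ j →
      ∑ i ∈ range (n - k + 1), ((n - k).choose i : ℤ) * x (j + i) = 0 by
    obtain ⟨x, hx, h⟩ := h (k + 1) le_rfl
    exact ⟨x, fun j hj => h j hj (by omega), hx⟩
  intro m
  induction m with
  | zero => exact fun _ => ⟨c, fun _ _ => rfl, fun j hj hj' => by omega⟩
  | succ m ih =>
    intro hm
    obtain ⟨x, hx, h⟩ := ih (by omega)
    set j₀ := k - m with hj₀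
    refine ⟨Function.update x j₀ (-∑ i ∈ range (n - k), ((n - k).choose (i + 1) : ℤ) *
      x (j₀ + (i + 1))), fun w hw => ?_, fun j hj hj' => ?_⟩
    · rw [Function.update_of_ne (by omega), hx w hw]
    · obtain rfl | hlt : j = j₀ ∨ j₀ < j := by omega
      · rw [sum_range_succ', Nat.choose_zero_right, Nat.add_zero, Function.update_self]
        rw [sum_congr rfl fun i _ => by rw [Function.update_of_ne (show j₀ + (i + 1) ≠ j₀ by omega)]]
        push_cast
        ring
      · rw [← h j hj (by omega)]
        exact sum_congr rfl fun i _ => by rw [Function.update_of_ne (by omega)]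

theorem sectorDet_eq_one_of_lt {n w : ℕ} (hw : n < w) (V : QubitOp n) : sectorDet w V = 1 := by
  have : IsEmpty {x : Fin n → Fin 2 // hammingNorm x = w} :=
    ⟨fun x => by
      have := hammingNorm_le x.1
      rw [x.2] at this
      omega⟩
  exact Matrix.det_isEmpty

/-- For `k ≥ 2` the group generated by the `k`-local symmetric unitaries is cut out of the group of
all symmetric unitaries by the monomials in the sector determinants. -/
theorem mem_circuitGroup_iff {n k : ℕ} (hk2 : 2 ≤ k) (hk : k ≤ n) {V : QubitUnitary n} :
    V ∈ circuitGroup n k ↔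
      V ∈ symmetricGroup n ∧ ∀ x, IsDetRelation n k x → detMonomial n x (V : QubitOp n) = 1 := by
  refine ⟨fun h => ⟨circuitGroup_le_symmetricGroup n k h,
    fun x hx => detMonomial_eq_one_of_mem_circuitGroup hk hx h⟩, fun ⟨hV, hχ⟩ => ?_⟩
  obtain ⟨U, hU, hUd⟩ := exists_mem_circuitGroup_sectorDet_eq hk
    (fun w => sectorDet w (V : QubitOp n)) (fun w => sectorDet_mul_star hV w)
  have hUG := circuitGroup_le_symmetricGroup n k hU
  have hR : V * U⁻¹ ∈ symmetricGroup n := mul_mem hV (inv_mem hUG)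
  have hUinv : ∀ w, sectorDet w (U : QubitOp n) * sectorDet w ((U⁻¹ : QubitUnitary n) : QubitOp n)
      = 1 := by
    intro w
    rw [← sectorDet_mul hUG, ← Submonoid.coe_mul, mul_inv_cancel, Submonoid.coe_one, sectorDet_one]
  have hlow : ∀ w ≤ k, sectorDet w ((V * U⁻¹ : QubitUnitary n) : QubitOp n) = 1 := by
    intro w hw
    rw [Submonoid.coe_mul, sectorDet_mul hV, ← hUd w hw, hUinv]
  have hall : ∀ w, sectorDet w ((V * U⁻¹ : QubitUnitary n) : QubitOp n) = 1 := by
    intro w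
    by_cases hwk : w ≤ k
    · exact hlow w hwk
    by_cases hwn : n < w
    · exact sectorDet_eq_one_of_lt hwn _
    obtain ⟨x, hx, hxc⟩ := exists_isDetRelation n k (fun v => if v = w then 1 else 0)
    have h1 : detMonomial n x ((V * U⁻¹ : QubitUnitary n) : QubitOp n) = 1 := by
      rw [Submonoid.coe_mul, detMonomial_mul x hV, hχ x hx, one_mul]
      exact detMonomial_eq_one_of_mem_circuitGroup hk hx (inv_mem hU)
    rw [detMonomial_eq_zpow x hR, prod_eq_single w, hxc w (by omega), if_pos rfl, zpow_one] at h1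
    · exact h1
    · intro v _ hv
      by_cases hvk : v ≤ k
      · rw [hlow v hvk, one_zpow]
      · rw [hxc v (by omega), if_neg hv, zpow_zero]
    · intro h
      exact absurd (mem_range.2 (by omega)) h
  have := mul_mem (mem_circuitGroup_of_sectorDet_eq_one hk2 hR hall) hU
  rwa [inv_mul_cancel_right] at this

/-! ### Compactness -/

instance compactSpace_qubitUnitary (n : ℕ) : CompactSpace (QubitUnitary n) := by
  refine isCompact_iff_compactSpace.1 (?_ : IsCompact (unitary (QubitOp n) : Set (QubitOp n)))
  have hK : IsCompact (Set.pi Set.univ fun _ => Set.pi Set.univ fun _ => Metric.closedBall 0 1 :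
      Set (QubitOp n)) :=
    isCompact_univ_pi fun _ => isCompact_univ_pi fun _ => isCompact_closedBall _ _
  have hcl : IsClosed (unitary (QubitOp n) : Set (QubitOp n)) := isClosed_unitary
  refine hK.of_isClosed_subset hcl ?_
  intro V hV i _ j _
  rw [mem_closedBall_zero_iff]
  exact entry_norm_bound_of_unitary hV i j

theorem continuous_entry {n : ℕ} (x y : Fin n → Fin 2) :
    Continuous fun V : QubitUnitary n => (V : QubitOp n) x y :=
  continuous_subtype_val.matrix_elem x y

theorem continuous_sectorDet {n : ℕ} (w : ℕ) :
    Continuous fun V : QubitUnitary n => sectorDet w (V : QubitOp n) :=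
  (continuous_subtype_val.matrix_submatrix _ _).matrix_det

theorem continuous_detMonomial {n : ℕ} (x : ℕ → ℤ) :
    Continuous fun V : QubitUnitary n => detMonomial n x (V : QubitOp n) :=
  continuous_finsetProd _ fun w _ =>
    ((continuous_sectorDet w).pow _).mul ((continuous_sectorDet w).star.pow _)

theorem isClosed_symmetricGroup (n : ℕ) : IsClosed (symmetricGroup n : Set (QubitUnitary n)) := by
  have : (symmetricGroup n : Set (QubitUnitary n)) =
      ⋂ θ : ℝ, {V : QubitUnitary n | (V : QubitOp n) * tensorPow n (chargeRep θ) =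
        tensorPow n (chargeRep θ) * (V : QubitOp n)} := by
    ext V
    simp only [Set.mem_iInter]
    rfl
  rw [this]
  exact isClosed_iInter fun θ => isClosed_eq (continuous_subtype_val.matrix_mul continuous_const)
    (continuous_const.matrix_mul continuous_subtype_val)

theorem isClosed_circuitGroup {n k : ℕ} (hk2 : 2 ≤ k) (hk : k ≤ n) :
    IsClosed (circuitGroup n k : Set (QubitUnitary n)) := by
  have : (circuitGroup n k : Set (QubitUnitary n)) = (symmetricGroup n : Set (QubitUnitary n)) ∩
      ⋂ (x : ℕ → ℤ) (_ : IsDetRelation n k x), {V : QubitUnitary n | detMonomial n x (V : QubitOp n) = 1} := by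
    ext V
    simp only [SetLike.mem_coe, mem_circuitGroup_iff hk2 hk, Set.mem_inter_iff, Set.mem_iInter]
    rfl
  rw [this]
  exact (isClosed_symmetricGroup n).inter (isClosed_iInter fun x => isClosed_iInter fun _ =>
    isClosed_eq (continuous_detMonomial x) continuous_const)

/-! ### Uniform distributions on closed groups of unitaries -/

section uniform

variable {n : ℕ} {W : Subgroup (QubitUnitary n)}

theorem compactSpace_of_isClosed (hW : IsClosed (W : Set (QubitUnitary n))) : CompactSpace W :=
  isCompact_iff_compactSpace.1 hW.isCompact

theorem uniformDistribution_of_compactSpace [h : CompactSpace W] :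
    uniformDistribution W =
      (Measure.haarMeasure (⊤ : TopologicalSpace.PositiveCompacts W)).map Subtype.val := by
  rw [uniformDistribution, dif_pos h]

theorem haar_univ [CompactSpace W] :
    IsProbabilityMeasure (Measure.haarMeasure (⊤ : TopologicalSpace.PositiveCompacts W)) :=
  ⟨Measure.haarMeasure_self⟩

theorem isProbabilityMeasure_uniformDistribution (hW : IsClosed (W : Set (QubitUnitary n))) :
    IsProbabilityMeasure (uniformDistribution W) := by
  have := compactSpace_of_isClosed hW
  have := haar_univ (W := W)
  rw [uniformDistribution_of_compactSpace]
  exact Measure.isProbabilityMeasure_map measurable_subtype_coe.aemeasurable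

theorem integral_uniformDistribution (hW : IsClosed (W : Set (QubitUnitary n))) [CompactSpace W]
    (f : QubitUnitary n → ℂ) :
    ∫ V, f V ∂(uniformDistribution W) =
      ∫ V : W, f V ∂(Measure.haarMeasure (⊤ : TopologicalSpace.PositiveCompacts W)) := by
  rw [uniformDistribution_of_compactSpace]
  exact (MeasurableEmbedding.subtype_coe hW.measurableSet).integral_map f

theorem integral_congr_uniformDistribution (hW : IsClosed (W : Set (QubitUnitary n)))
    {f g : QubitUnitary n → ℂ} (h : ∀ V ∈ W, f V = g V) :
    ∫ V, f V ∂(uniformDistribution W) = ∫ V, g V ∂(uniformDistribution W) := by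
  have := compactSpace_of_isClosed hW
  rw [integral_uniformDistribution hW, integral_uniformDistribution hW]
  exact integral_congr_ae (Filter.Eventually.of_forall fun V => h V V.2)

theorem integral_mul_left_uniformDistribution (hW : IsClosed (W : Set (QubitUnitary n)))
    (f : QubitUnitary n → ℂ) {g : QubitUnitary n} (hg : g ∈ W) :
    ∫ V, f (g * V) ∂(uniformDistribution W) = ∫ V, f V ∂(uniformDistribution W) := by
  have := compactSpace_of_isClosed hW
  rw [integral_uniformDistribution hW, integral_uniformDistribution hW]
  exact integral_mul_left_eq_self (fun V : W => f V) (⟨g, hg⟩ : W)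

theorem isMulRightInvariant_haar [CompactSpace W] :
    (Measure.haarMeasure (⊤ : TopologicalSpace.PositiveCompacts W)).IsMulRightInvariant := by
  have := haar_univ (W := W)
  refine ⟨fun g => ?_⟩
  have : IsProbabilityMeasure
      ((Measure.haarMeasure (⊤ : TopologicalSpace.PositiveCompacts W)).map (· * g)) :=
    Measure.isProbabilityMeasure_map (measurable_mul_const g).aemeasurable
  exact Measure.isHaarMeasure_eq_of_isProbabilityMeasure _ _

theorem integral_mul_right_uniformDistribution (hW : IsClosed (W : Set (QubitUnitary n)))
    (f : QubitUnitary n → ℂ) {g : QubitUnitary n} (hg : g ∈ W) :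
    ∫ V, f (V * g) ∂(uniformDistribution W) = ∫ V, f V ∂(uniformDistribution W) := by
  have := compactSpace_of_isClosed hW
  have := isMulRightInvariant_haar (W := W)
  rw [integral_uniformDistribution hW, integral_uniformDistribution hW]
  exact integral_mul_right_eq_self (fun V : W => f V) (⟨g, hg⟩ : W)

theorem integrable_uniformDistribution (hW : IsClosed (W : Set (QubitUnitary n)))
    {f : QubitUnitary n → ℂ} (hf : Continuous f) : Integrable f (uniformDistribution W) := by
  have := isProbabilityMeasure_uniformDistribution hW
  exact integrableOn_univ.1 (hf.continuousOn.integrableOn_compact isCompact_univ)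

end uniform

/-! ### Moments -/

theorem tensorPow_mul {m : Type*} [Fintype m] (t : ℕ) (A B : Matrix m m ℂ) :
    tensorPow t (A * B) = tensorPow t A * tensorPow t B := by
  classical
  ext x y
  simp only [tensorPow, Matrix.of_apply, Matrix.mul_apply]
  rw [prod_univ_sum, Fintype.piFinset_univ]
  exact sum_congr rfl fun z _ => prod_mul_distrib

theorem momentMatrix_mul {n : ℕ} (t : ℕ) (V W : QubitUnitary n) :
    momentMatrix t (V * W) = momentMatrix t V * momentMatrix t W := by
  rw [momentMatrix, momentMatrix, momentMatrix]
  have h : ((V * W : QubitUnitary n) : QubitOp n).map star =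
      (V : QubitOp n).map star * (W : QubitOp n).map star :=
    Matrix.map_mul (f := starRingEnd ℂ)
  rw [h, Submonoid.coe_mul, tensorPow_mul, tensorPow_mul]
  exact Matrix.mul_kronecker_mul _ _ _ _

theorem momentMatrix_apply {n : ℕ} (t : ℕ) (V : QubitUnitary n)
    (a b : (Fin t → Fin n → Fin 2) × (Fin t → Fin n → Fin 2)) :
    momentMatrix t V a b = (∏ i, (V : QubitOp n) (a.1 i) (b.1 i)) *
      ∏ i, star ((V : QubitOp n) (a.2 i) (b.2 i)) := rfl

theorem continuous_momentMatrix {n : ℕ} (t : ℕ)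
    (a b : (Fin t → Fin n → Fin 2) × (Fin t → Fin n → Fin 2)) :
    Continuous fun V : QubitUnitary n => momentMatrix t V a b :=
  (continuous_finsetProd univ fun i _ => continuous_entry (a.1 i) (b.1 i)).mul
    (continuous_finsetProd univ fun i _ => (continuous_entry (a.2 i) (b.2 i)).star)

/-- The averages over two closed groups `K ≤ G` agree as soon as every vector fixed by `K` is fixed
by `G`. -/
theorem isDesign_of_fixed {n t : ℕ} {K G : Subgroup (QubitUnitary n)} (hKG : K ≤ G)
    (hK : IsClosed (K : Set (QubitUnitary n))) (hG : IsClosed (G : Set (QubitUnitary n)))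
    (hfix : ∀ ξ : (Fin t → Fin n → Fin 2) × (Fin t → Fin n → Fin 2) → ℂ,
      (∀ V ∈ K, momentMatrix t V *ᵥ ξ = ξ) → ∀ V ∈ G, momentMatrix t V *ᵥ ξ = ξ) :
    IsDesign t (uniformDistribution K) (uniformDistribution G) := by
  have := isProbabilityMeasure_uniformDistribution hK
  have := isProbabilityMeasure_uniformDistribution hG
  intro a b
  have hint : ∀ {W : Subgroup (QubitUnitary n)} (_ : IsClosed (W : Set (QubitUnitary n)))
      (c d : (Fin t → Fin n → Fin 2) × (Fin t → Fin n → Fin 2)),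
      Integrable (fun U => momentMatrix t U c d) (uniformDistribution W) := fun hW c d =>
    integrable_uniformDistribution hW (continuous_momentMatrix t c d)
  -- the columns of the average over `K` are fixed by `K`, hence by `G`, so multiplying that average
  -- by the average over `G` leaves it unchanged; but the average over `G` absorbs `K`
  set ξ : (Fin t → Fin n → Fin 2) × (Fin t → Fin n → Fin 2) → ℂ :=
    fun c => ∫ U, momentMatrix t U c b ∂(uniformDistribution K) with hξ
  have hξK : ∀ V ∈ K, momentMatrix t V *ᵥ ξ = ξ := by
    intro V hV
    funext c
    have h := integral_mul_left_uniformDistribution hK (fun U => momentMatrix t U c b) hV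
    simp only [momentMatrix_mul, Matrix.mul_apply] at h
    rw [integral_finsetSum _ fun d _ => (hint hK d b).const_mul _] at h
    simp only [integral_const_mul] at h
    exact h
  have hξG := hfix ξ hξK
  calc ξ a = ∫ _ : QubitUnitary n, ξ a ∂(uniformDistribution G) := by simp
    _ = ∫ V, ∑ c, momentMatrix t V a c * ξ c ∂(uniformDistribution G) :=
        integral_congr_uniformDistribution hG fun V hV => (congrFun (hξG V hV) a).symm
    _ = ∑ c, (∫ V, momentMatrix t V a c ∂(uniformDistribution G)) * ξ c := by
        rw [integral_finsetSum _ fun c _ => (hint hG a c).mul_const _]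
        simp only [integral_mul_const]
    _ = ∫ U, ∑ c, (∫ V, momentMatrix t V a c ∂(uniformDistribution G)) * momentMatrix t U c b
          ∂(uniformDistribution K) := by
        rw [integral_finsetSum _ fun c _ => (hint hK c b).const_mul _]
        simp only [integral_const_mul, hξ]
    _ = ∫ _ : QubitUnitary n, (∫ V, momentMatrix t V a b ∂(uniformDistribution G))
          ∂(uniformDistribution K) := by
        refine integral_congr_uniformDistribution hK fun U hU => ?_
        have h := integral_mul_right_uniformDistribution hG (fun V => momentMatrix t V a b) (hKG hU)
        simp only [momentMatrix_mul, Matrix.mul_apply] at h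
        rw [integral_finsetSum _ fun c _ => (hint hG a c).mul_const _]
          at h
        simp only [integral_mul_const] at h
        exact h
    _ = ∫ V, momentMatrix t V a b ∂(uniformDistribution G) := by simp

/-! ### Vectors fixed by the circuits -/

/-- The unitary acting as the phase `z w` on the sector of Hamming weight `w`. -/
noncomputable def sectorPhase (n : ℕ) (z : ℕ → ℂ) (hz : ∀ w, z w * star (z w) = 1) :
    QubitUnitary n :=
  ⟨Matrix.diagonal fun x => z (hammingNorm x), Matrix.mem_unitaryGroup_iff.2 (by
    rw [Matrix.star_eq_conjTranspose, Matrix.diagonal_conjTranspose,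
      Matrix.diagonal_mul_diagonal, ← Matrix.diagonal_one]
    congr 1
    funext x
    exact hz _)⟩

theorem sectorPhase_mem_symmetricGroup {n : ℕ} {z : ℕ → ℂ} (hz : ∀ w, z w * star (z w) = 1) :
    sectorPhase n z hz ∈ symmetricGroup n :=
  isSymmetric_diagonal _

theorem sectorDet_sectorPhase {n : ℕ} {z : ℕ → ℂ} (hz : ∀ w, z w * star (z w) = 1) (w : ℕ) :
    sectorDet w (sectorPhase n z hz : QubitOp n) = z w ^ n.choose w := by
  have h := card_hammingNorm_eq (Fin n) w
  rw [Fintype.card_fin] at h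
  rw [sectorPhase, sectorDet_diagonal, ← h, ← prod_const]
  exact prod_congr rfl fun x hx => by rw [(mem_filter.1 hx).2]

/-- The number of tensor factors of the first kind in a given sector, minus the number of tensor
factors of the second kind in that sector. -/
def weightExcess {n t : ℕ} (c : (Fin t → Fin n → Fin 2) × (Fin t → Fin n → Fin 2)) (w : ℕ) : ℤ :=
  (#{i | hammingNorm (c.1 i) = w} : ℤ) - #{i | hammingNorm (c.2 i) = w}

theorem prod_comp_hammingNorm {n t : ℕ} (z : ℕ → ℂ) (a : Fin t → Fin n → Fin 2) :
    ∏ i, z (hammingNorm (a i)) = ∏ w ∈ range (n + 1), z w ^ #{i | hammingNorm (a i) = w} := by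
  rw [← prod_fiberwise_of_maps_to (s := univ) (t := range (n + 1)) (g := fun i => hammingNorm (a i))
    (fun i _ => mem_range.2 (Nat.lt_succ_of_le (hammingNorm_le (a i))))]
  refine prod_congr rfl fun w _ => ?_
  rw [← prod_const]
  exact prod_congr rfl fun i hi => by rw [(mem_filter.1 hi).2]

theorem sum_card_hammingNorm {n t : ℕ} (a : Fin t → Fin n → Fin 2) :
    ∑ w ∈ range (n + 1), #{i | hammingNorm (a i) = w} = t := by
  rw [← card_eq_sum_card_fiberwise (s := univ) (f := fun i => hammingNorm (a i))
    (fun i _ => by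
      simpa using Nat.lt_succ_of_le (hammingNorm_le (a i)))]
  simp

theorem sum_abs_weightExcess_le {n t : ℕ}
    (c : (Fin t → Fin n → Fin 2) × (Fin t → Fin n → Fin 2)) :
    ∑ w ∈ range (n + 1), |weightExcess c w| ≤ 2 * t := by
  calc ∑ w ∈ range (n + 1), |weightExcess c w|
      ≤ ∑ w ∈ range (n + 1),
        ((#{i | hammingNorm (c.1 i) = w} : ℤ) + #{i | hammingNorm (c.2 i) = w}) :=
        sum_le_sum fun w _ => by
          rw [weightExcess, abs_le]
          constructor <;> omega
    _ = 2 * t := by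
        rw [sum_add_distrib, ← Nat.cast_sum, ← Nat.cast_sum, sum_card_hammingNorm,
          sum_card_hammingNorm]
        ring

theorem momentMatrix_sectorPhase_mulVec {n t : ℕ} {z : ℕ → ℂ} (hz : ∀ w, z w * star (z w) = 1)
    (ξ : (Fin t → Fin n → Fin 2) × (Fin t → Fin n → Fin 2) → ℂ)
    (c : (Fin t → Fin n → Fin 2) × (Fin t → Fin n → Fin 2)) :
    (momentMatrix t (sectorPhase n z hz) *ᵥ ξ) c =
      (∏ w ∈ range (n + 1), z w ^ weightExcess c w) * ξ c := by
  have hoff : ∀ (a b : Fin t → Fin n → Fin 2), a ≠ b →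
      ∃ i, (sectorPhase n z hz : QubitOp n) (a i) (b i) = 0 := by
    intro a b hab
    obtain ⟨i, hi⟩ := Function.ne_iff.1 hab
    exact ⟨i, Matrix.diagonal_apply_ne _ hi⟩
  rw [Matrix.mulVec, dotProduct, Fintype.sum_eq_single c]
  · rw [momentMatrix_apply]
    have hd : ∀ x, (sectorPhase n z hz : QubitOp n) x x = z (hammingNorm x) :=
      fun x => Matrix.diagonal_apply_eq _ _
    simp only [hd]
    rw [prod_comp_hammingNorm z c.1, prod_comp_hammingNorm (fun w => star (z w)) c.2,
      ← prod_mul_distrib]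
    congr 1
    refine prod_congr rfl fun w _ => ?_
    have hne : z w ≠ 0 := left_ne_zero_of_mul_eq_one (hz w)
    rw [weightExcess, zpow_sub₀ hne, zpow_natCast, zpow_natCast, div_eq_mul_inv, ← inv_pow,
      ← eq_inv_of_mul_eq_one_right (hz w)]
  · intro d hd
    rw [momentMatrix_apply]
    by_cases h1 : c.1 = d.1
    · have h2 : c.2 ≠ d.2 := fun h2 => hd (Prod.ext h1 h2).symm
      obtain ⟨i, hi⟩ := hoff _ _ h2
      rw [prod_eq_zero (f := fun i => star ((sectorPhase n z hz : QubitOp n) (c.2 i) (d.2 i)))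
        (mem_univ i) (by rw [hi, star_zero]), mul_zero, zero_mul]
    · obtain ⟨i, hi⟩ := hoff _ _ h1
      rw [prod_eq_zero (mem_univ i) hi, zero_mul, zero_mul]

theorem exp_mul_I_mul_star (a : ℝ) :
    Complex.exp (a * Complex.I) * star (Complex.exp (a * Complex.I)) = 1 := by
  rw [Complex.star_def, ← Complex.exp_conj, ← Complex.exp_add]
  simp

theorem sectorPhase_mem_circuitGroup {n k : ℕ} (hk2 : 2 ≤ k) (hk : k ≤ n) {z : ℕ → ℂ}
    (hz : ∀ w, z w * star (z w) = 1)
    (h : ∀ x, IsDetRelation n k x → ∏ w ∈ range (n + 1), (z w ^ n.choose w) ^ x w = 1) :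
    sectorPhase n z hz ∈ circuitGroup n k := by
  have hmem := sectorPhase_mem_symmetricGroup (n := n) hz
  refine (mem_circuitGroup_iff hk2 hk).2 ⟨hmem, fun x hx => ?_⟩
  rw [detMonomial_eq_zpow x hmem, ← h x hx]
  exact prod_congr rfl fun w _ => by rw [sectorDet_sectorPhase]

theorem sum_choose_sub_mul (n k j : ℕ) (hk : k ≤ n) (hj : j ≤ k) (x : ℕ → ℤ) :
    ∑ w ∈ range (n + 1), (if j ≤ w then ((n - k).choose (w - j) : ℤ) else 0) * x w =
      ∑ i ∈ range (n - k + 1), ((n - k).choose i : ℤ) * x (j + i) := by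
  rw [show n + 1 = j + ((n - k + 1) + (k - j)) by omega, sum_range_add, sum_range_add,
    Finset.sum_eq_zero fun w hw => by
      rw [if_neg (by have := mem_range.1 hw; omega), zero_mul],
    Finset.sum_eq_zero (s := range (k - j)) fun w _ => by
      rw [if_pos (by omega), Nat.choose_eq_zero_of_lt (by omega)]; simp]
  rw [zero_add, add_zero]
  exact sum_congr rfl fun i _ => by rw [if_pos (by omega), Nat.add_sub_cancel_left]

/-- A sector excess that no sector phase among the circuits detects comes from a relation. -/
theorem exists_isDetRelation_of_forall_phase {n k : ℕ} (hk2 : 2 ≤ k) (hk : k ≤ n) (e : ℕ → ℤ)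
    (h : ∀ (z : ℕ → ℂ) (hz : ∀ w, z w * star (z w) = 1), sectorPhase n z hz ∈ circuitGroup n k →
      ∏ w ∈ range (n + 1), z w ^ e w = 1) :
    ∃ x, IsDetRelation n k x ∧ ∀ w ≤ n, e w = n.choose w * x w := by
  have hdvd : ∀ w, ∃ a : ℤ, w ≤ n → e w = n.choose w * a := by
    intro w
    by_cases hw : w ≤ n
    swap
    · exact ⟨0, fun h => absurd h hw⟩
    have hm : n.choose w ≠ 0 := (Nat.choose_pos hw).ne'
    -- a primitive root of unity of order `n.choose w` on one sector has trivial determinants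
    have hζ := Complex.isPrimitiveRoot_exp _ hm
    set ζ := Complex.exp (2 * Real.pi * Complex.I / (n.choose w : ℕ)) with hζdef
    have hζ1 : ζ * star ζ = 1 := by
      rw [Complex.star_def, Complex.mul_conj, Complex.normSq_eq_norm_sq,
        hζ.norm'_eq_one hm]
      simp
    have hz : ∀ v, Pi.mulSingle (M := fun _ : ℕ => ℂ) w ζ v *
        star (Pi.mulSingle (M := fun _ : ℕ => ℂ) w ζ v) = 1 := by
      intro v
      by_cases hv : v = w
      · subst hv
        rw [Pi.mulSingle_eq_same]
        exact hζ1
      · rw [Pi.mulSingle_eq_of_ne hv]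
        simp
    have h1 := h _ hz (sectorPhase_mem_circuitGroup hk2 hk hz fun x _ =>
      prod_eq_one fun v _ => by
        by_cases hv : v = w
        · subst hv
          rw [Pi.mulSingle_eq_same, hζ.pow_eq_one, one_zpow]
        · rw [Pi.mulSingle_eq_of_ne hv, one_pow, one_zpow])
    rw [prod_eq_single w (fun v _ hv => by rw [Pi.mulSingle_eq_of_ne hv, one_zpow])
      (fun hw' => absurd (mem_range.2 (by omega)) hw'), Pi.mulSingle_eq_same,
      hζ.zpow_eq_one_iff_dvd] at h1
    obtain ⟨a, ha⟩ := h1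
    exact ⟨a, fun _ => ha⟩
  choose x hx using hdvd
  refine ⟨x, fun j hj => ?_, hx⟩
  rw [← sum_choose_sub_mul n k j hk hj x]
  set c : ℕ → ℤ := fun w => if j ≤ w then ((n - k).choose (w - j) : ℤ) else 0 with hc
  by_contra hN
  -- `c w` is the exponent of a `k`-qubit phase on weight `j` in the determinant of the sector `w`
  set N : ℤ := ∑ w ∈ range (n + 1), c w * x w with hNdef
  -- sector phases whose determinants are those of such a `k`-qubit phase, of angle `π / N`
  set z : ℕ → ℂ := fun w =>
    Complex.exp (((Real.pi / N * (c w / n.choose w) : ℝ) : ℂ) * Complex.I) with hzdef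
  have hz : ∀ w, z w * star (z w) = 1 := fun w => exp_mul_I_mul_star _
  have hkey : ∀ y : ℕ → ℤ, ∏ w ∈ range (n + 1), (z w ^ n.choose w) ^ y w =
      Complex.exp (((Real.pi / N * ((∑ w ∈ range (n + 1), c w * y w : ℤ) : ℝ) : ℝ) : ℂ) *
        Complex.I) := by
    intro y
    push_cast
    rw [mul_sum, sum_mul, Complex.exp_sum]
    refine prod_congr rfl fun w hw => ?_
    have hm : (n.choose w : ℂ) ≠ 0 := by
      exact_mod_cast (Nat.choose_pos (by have := mem_range.1 hw; omega)).ne'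
    rw [hzdef]
    beta_reduce
    rw [← Complex.exp_nat_mul, ← Complex.exp_int_mul]
    congr 1
    push_cast
    field_simp
  have hmem := sectorPhase_mem_circuitGroup hk2 hk hz fun y hy => by
    rw [hkey y, hc, sum_choose_sub_mul n k j hk hj y, hy j hj]
    simp
  have h1 := h z hz hmem
  have h2 : ∏ w ∈ range (n + 1), z w ^ e w = ∏ w ∈ range (n + 1), (z w ^ n.choose w) ^ x w :=
    prod_congr rfl fun w hw => by
      rw [hx w (by have := mem_range.1 hw; omega), zpow_mul, zpow_natCast]
  rw [h2, hkey x, ← hNdef] at h1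
  have hN' : (N : ℝ) ≠ 0 := by exact_mod_cast hN
  rw [div_mul_cancel₀ _ hN', Complex.exp_pi_mul_I] at h1
  norm_num at h1

/-- The sector phases absorb all sector determinants, and the circuits contain everything of
determinant `1` in each sector. -/
theorem exists_mem_circuitGroup_mul_sectorPhase {n k : ℕ} (hk2 : 2 ≤ k)
    {V : QubitUnitary n} (hV : V ∈ symmetricGroup n) :
    ∃ U ∈ circuitGroup n k, ∃ z, ∃ hz : ∀ w, z w * star (z w) = 1,
      V = U * sectorPhase n z hz := by
  have hroot : ∀ w, ∃ ζ : ℂ, ζ * star ζ = 1 ∧ ζ ^ n.choose w = sectorDet w (V : QubitOp n) := by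
    intro w
    by_cases hw : n < w
    · exact ⟨1, by simp, by rw [one_pow, sectorDet_eq_one_of_lt hw]⟩
    have hm := Nat.choose_pos (not_lt.1 hw)
    obtain ⟨ζ, hζ⟩ := IsAlgClosed.exists_pow_nat_eq (sectorDet w (V : QubitOp n)) hm
    refine ⟨ζ, ?_, hζ⟩
    have h1 : ‖ζ‖ ^ n.choose w = 1 := by
      rw [← norm_pow, hζ]
      have h2 := congrArg norm (sectorDet_mul_star hV w)
      rw [norm_mul, norm_star, norm_one, ← sq] at h2
      exact (pow_eq_one_iff_of_nonneg (norm_nonneg _) two_ne_zero).1 h2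
    rw [Complex.star_def, Complex.mul_conj, Complex.normSq_eq_norm_sq,
      (pow_eq_one_iff_of_nonneg (norm_nonneg _) hm.ne').1 h1]
    simp
  choose z hz hzV using hroot
  have hS := sectorPhase_mem_symmetricGroup (n := n) hz
  refine ⟨V * (sectorPhase n z hz)⁻¹, ?_, z, hz, by rw [inv_mul_cancel_right]⟩
  refine mem_circuitGroup_of_sectorDet_eq_one hk2 (mul_mem hV (inv_mem hS)) fun w => ?_
  rw [Submonoid.coe_mul, sectorDet_mul hV, ← hzV w, ← sectorDet_sectorPhase hz w,
    ← sectorDet_mul hS, ← Submonoid.coe_mul, mul_inv_cancel, Submonoid.coe_one, sectorDet_one]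

/-- If every nonzero relation costs more than `t` copies of `V` and `V^*`, the circuits form a
`t`-design. -/
theorem isDesign_of_lt_detCost {n k t : ℕ} (hk2 : 2 ≤ k) (hk : k ≤ n)
    (hmin : ∀ x, IsDetRelation n k x → (∃ w ≤ n, x w ≠ 0) → 2 * (t : ℤ) < detCost n x) :
    IsDesign t (uniformDistribution (circuitGroup n k)) (uniformDistribution (symmetricGroup n)) := by
  refine isDesign_of_fixed (circuitGroup_le_symmetricGroup n k) (isClosed_circuitGroup hk2 hk)
    (isClosed_symmetricGroup n) fun ξ hξ V hV => ?_
  have hexcess : ∀ c, ξ c ≠ 0 → ∀ w ≤ n, weightExcess c w = 0 := by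
    intro c hc
    obtain ⟨x, hx, hxe⟩ := exists_isDetRelation_of_forall_phase hk2 hk (weightExcess c)
      fun z hz hmem => by
        have h := congrFun (hξ _ hmem) c
        rw [momentMatrix_sectorPhase_mulVec] at h
        exact mul_right_cancel₀ hc (h.trans (one_mul _).symm)
    by_contra! hne
    obtain ⟨w, hw, hne⟩ := hne
    have h1 := hmin x hx ⟨w, hw, fun h0 => hne (by rw [hxe w hw, h0, mul_zero])⟩
    have h2 := sum_abs_weightExcess_le c
    have h3 : detCost n x = ∑ w ∈ range (n + 1), |weightExcess c w| :=
      sum_congr rfl fun w hw => by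
        rw [hxe w (by have := mem_range.1 hw; omega), abs_mul, Nat.abs_cast]
    omega
  obtain ⟨U, hU, z, hz, rfl⟩ := exists_mem_circuitGroup_mul_sectorPhase hk2 hV
  have hS : momentMatrix t (sectorPhase n z hz) *ᵥ ξ = ξ := by
    funext c
    rw [momentMatrix_sectorPhase_mulVec]
    by_cases hc : ξ c = 0
    · rw [hc, mul_zero]
    · rw [prod_eq_one fun w hw => by
        rw [hexcess c hc w (by have := mem_range.1 hw; omega), zpow_zero], one_mul]
  rw [momentMatrix_mul, ← Matrix.mulVec_mulVec, hS, hξ U hU]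

/-! ### Polynomials in the entries of a unitary and their conjugates -/

theorem prod_mem_submodule_prod {R A ι : Type*} [CommSemiring R] [CommSemiring A] [Algebra R A]
    (s : Finset ι) {N : ι → Submodule R A} {f : ι → A} (h : ∀ i ∈ s, f i ∈ N i) :
    ∏ i ∈ s, f i ∈ ∏ i ∈ s, N i := by
  classical
  induction s using Finset.induction_on with
  | empty =>
    rw [prod_empty, prod_empty]
    exact Submodule.one_le.1 le_rfl
  | insert a s ha ih =>
    rw [prod_insert ha, prod_insert ha]
    exact Submodule.mul_mem_mul (h a (mem_insert_self a s))
      (ih fun i hi => h i (mem_insert_of_mem hi))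

theorem det_mem_submodule_pow {R A ι : Type*} [CommRing R] [CommRing A] [Algebra R A] [Fintype ι]
    [DecidableEq ι] {N : Submodule R A} {F : Matrix ι ι A} (h : ∀ i j, F i j ∈ N) :
    F.det ∈ N ^ Fintype.card ι := by
  rw [Matrix.det_apply]
  refine Submodule.sum_mem _ fun σ _ => ?_
  have h1 : ∏ i, F (σ i) i ∈ N ^ Fintype.card ι := by
    rw [← card_univ, ← prod_const]
    exact prod_mem_submodule_prod univ fun i _ => h _ _
  rcases Int.units_eq_one_or (Equiv.Perm.sign σ) with hs | hs
  · rwa [hs, one_smul]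
  · rw [hs, Units.neg_smul, one_smul]
    exact Submodule.neg_mem _ h1

/-- The span of the entries, as functions on the unitary group. -/
noncomputable def entrySpace (n : ℕ) : Submodule ℂ (QubitUnitary n → ℂ) :=
  Submodule.span ℂ (Set.range fun p : (Fin n → Fin 2) × (Fin n → Fin 2) =>
    fun V : QubitUnitary n => (V : QubitOp n) p.1 p.2)

/-- The span of the conjugates of the entries, as functions on the unitary group. -/
noncomputable def conjEntrySpace (n : ℕ) : Submodule ℂ (QubitUnitary n → ℂ) :=
  Submodule.span ℂ (Set.range fun p : (Fin n → Fin 2) × (Fin n → Fin 2) =>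
    fun V : QubitUnitary n => star ((V : QubitOp n) p.1 p.2))

theorem sectorDet_mem_pow (n w : ℕ) :
    (fun V : QubitUnitary n => sectorDet w (V : QubitOp n)) ∈ entrySpace n ^ n.choose w := by
  have hcard : Fintype.card {x : Fin n → Fin 2 // hammingNorm x = w} = n.choose w := by
    rw [Fintype.card_subtype, card_hammingNorm_eq, Fintype.card_fin]
  set F : Matrix {x : Fin n → Fin 2 // hammingNorm x = w} {x : Fin n → Fin 2 // hammingNorm x = w}
    (QubitUnitary n → ℂ) := Matrix.of fun x y V => (V : QubitOp n) x y with hF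
  have h : F.det ∈ entrySpace n ^ Fintype.card {x : Fin n → Fin 2 // hammingNorm x = w} :=
    det_mem_submodule_pow fun x y => Submodule.subset_span ⟨(x.1, y.1), rfl⟩
  rw [hcard] at h
  convert h using 1
  funext V
  exact (RingHom.map_det (Pi.evalRingHom (fun _ : QubitUnitary n => ℂ) V) F).symm

theorem star_sectorDet_mem_pow (n w : ℕ) :
    (fun V : QubitUnitary n => star (sectorDet w (V : QubitOp n))) ∈
      conjEntrySpace n ^ n.choose w := by
  have hcard : Fintype.card {x : Fin n → Fin 2 // hammingNorm x = w} = n.choose w := by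
    rw [Fintype.card_subtype, card_hammingNorm_eq, Fintype.card_fin]
  set F : Matrix {x : Fin n → Fin 2 // hammingNorm x = w} {x : Fin n → Fin 2 // hammingNorm x = w}
    (QubitUnitary n → ℂ) := Matrix.of fun x y V => star ((V : QubitOp n) y x) with hF
  have h : F.det ∈ conjEntrySpace n ^ Fintype.card {x : Fin n → Fin 2 // hammingNorm x = w} :=
    det_mem_submodule_pow fun x y => Submodule.subset_span ⟨(y.1, x.1), rfl⟩
  rw [hcard] at h
  convert h using 1
  funext V
  rw [← sectorDet_star]
  exact (RingHom.map_det (Pi.evalRingHom (fun _ : QubitUnitary n => ℂ) V) F).symm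

/-- The number of copies of `V` in the monomial with exponents `x`. -/
def detDegree (n : ℕ) (x : ℕ → ℤ) : ℕ := ∑ w ∈ range (n + 1), n.choose w * (x w).toNat

theorem detMonomial_mem (n : ℕ) (x : ℕ → ℤ) :
    (fun V : QubitUnitary n => detMonomial n x (V : QubitOp n)) ∈
      entrySpace n ^ detDegree n x * conjEntrySpace n ^ detDegree n fun w => -x w := by
  have h := prod_mem_submodule_prod (range (n + 1))
    (N := fun w => (entrySpace n ^ n.choose w) ^ (x w).toNat *
      (conjEntrySpace n ^ n.choose w) ^ (-x w).toNat)
    (f := fun w V => sectorDet w (V : QubitOp n) ^ (x w).toNat *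
      star (sectorDet w (V : QubitOp n)) ^ (-x w).toNat) fun w _ =>
      Submodule.mul_mem_mul (Submodule.pow_mem_pow _ (sectorDet_mem_pow n w) _)
        (Submodule.pow_mem_pow _ (star_sectorDet_mem_pow n w) _)
  simp only [← pow_mul, prod_mul_distrib, prod_pow_eq_pow_sum] at h
  rw [detDegree, detDegree]
  convert h using 1
  funext V
  simp [detMonomial, prod_mul_distrib]

theorem IsDetRelation.detDegree_neg {n k : ℕ} {x : ℕ → ℤ} (hk : k ≤ n) (hx : IsDetRelation n k x) :
    (detDegree n fun w => -x w) = detDegree n x := by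
  have h := hx.sum_eq_zero hk
  zify [detDegree]
  rw [← sub_eq_zero, ← sum_sub_distrib, ← neg_eq_zero, ← sum_neg_distrib, ← h]
  refine sum_congr rfl fun w _ => ?_
  have : ((x w).toNat : ℤ) - (-x w).toNat = x w := by omega
  linear_combination (n.choose w : ℤ) * this

theorem IsDetRelation.two_mul_detDegree {n k : ℕ} {x : ℕ → ℤ} (hk : k ≤ n)
    (hx : IsDetRelation n k x) : 2 * (detDegree n x : ℤ) = detCost n x := by
  have h := hx.detDegree_neg hk
  rw [two_mul]
  nth_rewrite 2 [← h]
  zify [detDegree, detCost]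
  rw [← sum_add_distrib]
  refine sum_congr rfl fun w _ => ?_
  have : ((x w).toNat : ℤ) + (-x w).toNat = |x w| := by
    rcases abs_cases (x w) with h | h <;> omega
  linear_combination (n.choose w : ℤ) * this

/-- A design reproduces the averages of all polynomials of degree `t` in the entries and degree `t` in
their conjugates. -/
theorem IsDesign.integral_eq {n t : ℕ} {K G : Subgroup (QubitUnitary n)}
    (hK : IsClosed (K : Set (QubitUnitary n))) (hG : IsClosed (G : Set (QubitUnitary n)))
    (h : IsDesign t (uniformDistribution K) (uniformDistribution G)) {f : QubitUnitary n → ℂ}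
    (hf : f ∈ entrySpace n ^ t * conjEntrySpace n ^ t) :
    ∫ V, f V ∂(uniformDistribution K) = ∫ V, f V ∂(uniformDistribution G) := by
  suffices hs : Continuous f ∧
      ∫ V, f V ∂(uniformDistribution K) = ∫ V, f V ∂(uniformDistribution G) from hs.2
  rw [entrySpace, conjEntrySpace, Submodule.span_pow, Submodule.span_pow,
    Submodule.span_mul_span] at hf
  induction hf using Submodule.span_induction with
  | mem f hf =>
    obtain ⟨g, hg, g', hg', rfl⟩ := Set.mem_mul.1 hf
    obtain ⟨p, rfl⟩ := Set.mem_pow.1 hg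
    obtain ⟨q, rfl⟩ := Set.mem_pow.1 hg'
    choose a ha using fun i => (p i).2
    choose b hb using fun i => (q i).2
    have hfun : (List.ofFn fun i => (p i : QubitUnitary n → ℂ)).prod *
        (List.ofFn fun i => (q i : QubitUnitary n → ℂ)).prod = fun V =>
        momentMatrix t V (fun i => (a i).1, fun i => (b i).1)
          (fun i => (a i).2, fun i => (b i).2) := by
      funext V
      rw [momentMatrix_apply, Pi.mul_apply, List.prod_ofFn, List.prod_ofFn, Finset.prod_apply,
        Finset.prod_apply]
      congr 1
      · exact prod_congr rfl fun i _ => (congrFun (ha i) V).symm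
      · exact prod_congr rfl fun i _ => (congrFun (hb i) V).symm
    rw [hfun]
    exact ⟨continuous_momentMatrix _ _ _, h _ _⟩
  | zero => exact ⟨continuous_const, by simp⟩
  | add f g _ _ hf hg =>
    refine ⟨hf.1.add hg.1, ?_⟩
    simp only [Pi.add_apply]
    rw [integral_add (integrable_uniformDistribution hK hf.1)
      (integrable_uniformDistribution hK hg.1), integral_add
      (integrable_uniformDistribution hG hf.1) (integrable_uniformDistribution hG hg.1), hf.2, hg.2]
  | smul c f _ hf =>
    refine ⟨hf.1.const_smul c, ?_⟩
    simp only [Pi.smul_apply]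
    rw [integral_smul, integral_smul, hf.2]

theorem exists_detMonomial_eq_neg_one {n : ℕ} {x : ℕ → ℤ} (hx : ∃ w ≤ n, x w ≠ 0) :
    ∃ V ∈ symmetricGroup n, detMonomial n x (V : QubitOp n) = -1 := by
  obtain ⟨w, hw, hxw⟩ := hx
  set z : ℕ → ℂ := fun v => Complex.exp (((if v = w then Real.pi / (n.choose w * x w) else 0 : ℝ) :
    ℂ) * Complex.I) with hz
  have hz1 : ∀ v, z v * star (z v) = 1 := fun v => exp_mul_I_mul_star _
  have hmem := sectorPhase_mem_symmetricGroup (n := n) hz1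
  refine ⟨_, hmem, ?_⟩
  rw [detMonomial_eq_zpow x hmem, prod_eq_single w]
  · rw [sectorDet_sectorPhase, hz]
    beta_reduce
    rw [if_pos rfl, ← Complex.exp_nat_mul, ← Complex.exp_int_mul, ← Complex.exp_pi_mul_I]
    congr 1
    have h1 : (n.choose w : ℂ) ≠ 0 := by exact_mod_cast (Nat.choose_pos hw).ne'
    have h2 : (x w : ℂ) ≠ 0 := by exact_mod_cast hxw
    push_cast
    field_simp
  · intro v _ hv
    rw [sectorDet_sectorPhase, hz]
    beta_reduce
    rw [if_neg hv]
    simp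
  · intro h
    exact absurd (mem_range.2 (by omega)) h

/-- A nonzero relation that costs at most `t` copies of `V` and `V^*` gives a polynomial whose
average is `1` over the circuits and `0` over all symmetric unitaries. -/
theorem not_isDesign_of_detCost_le {n k t : ℕ} (hk2 : 2 ≤ k) (hk : k ≤ n) {x : ℕ → ℤ}
    (hx : IsDetRelation n k x) (hx0 : ∃ w ≤ n, x w ≠ 0) (ht : detCost n x ≤ 2 * t) :
    ¬ IsDesign t (uniformDistribution (circuitGroup n k))
      (uniformDistribution (symmetricGroup n)) := by
  intro hdes
  have hK := isClosed_circuitGroup hk2 hk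
  have hG := isClosed_symmetricGroup n
  have hdeg := hx.two_mul_detDegree hk
  obtain ⟨s, rfl⟩ : ∃ s, t = detDegree n x + s := ⟨t - detDegree n x, by omega⟩
  -- the unused copies of `V` and `V^*` are filled with the one-dimensional sector of weight `0`
  have hmem : (fun V : QubitUnitary n => detMonomial n x (V : QubitOp n) *
      (sectorDet 0 (V : QubitOp n) ^ s * star (sectorDet 0 (V : QubitOp n)) ^ s)) ∈
      entrySpace n ^ (detDegree n x + s) * conjEntrySpace n ^ (detDegree n x + s) := by
    have h1 := detMonomial_mem n x
    rw [hx.detDegree_neg hk] at h1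
    have h2 := Submodule.mul_mem_mul (Submodule.pow_mem_pow _ (sectorDet_mem_pow n 0) s)
      (Submodule.pow_mem_pow _ (star_sectorDet_mem_pow n 0) s)
    rw [Nat.choose_zero_right, pow_one, pow_one] at h2
    have h3 := Submodule.mul_mem_mul h1 h2
    rw [mul_mul_mul_comm, ← pow_add, ← pow_add] at h3
    exact h3
  have heq := hdes.integral_eq hK hG hmem
  have hfill : ∀ V ∈ symmetricGroup n, detMonomial n x (V : QubitOp n) *
      (sectorDet 0 (V : QubitOp n) ^ s * star (sectorDet 0 (V : QubitOp n)) ^ s) =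
      detMonomial n x (V : QubitOp n) := by
    intro V hV
    rw [← mul_pow, sectorDet_mul_star hV, one_pow, mul_one]
  rw [integral_congr_uniformDistribution hG hfill,
    integral_congr_uniformDistribution hK (g := fun _ => 1) fun V hV => by
      rw [hfill V (circuitGroup_le_symmetricGroup n k hV),
        detMonomial_eq_one_of_mem_circuitGroup hk hx hV]] at heq
  have := isProbabilityMeasure_uniformDistribution hK
  obtain ⟨g, hg, hgx⟩ := exists_detMonomial_eq_neg_one hx0
  have hinv := integral_mul_left_uniformDistribution hG
    (fun V => detMonomial n x (V : QubitOp n)) hg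
  simp only [Submonoid.coe_mul, detMonomial_mul x hg, hgx] at hinv
  rw [integral_const_mul, ← heq] at hinv
  norm_num at hinv

/-! ### The trace norm and the largest design order -/

theorem opF_eq_diagonal (n k : ℕ) :
    opF n k = Matrix.diagonal fun x => (fEigenvalue n k (hammingNorm x) : ℂ) := by
  ext x y
  rw [opF, Matrix.sum_apply, Matrix.diagonal_apply]
  simp only [weightProjector, Matrix.smul_apply, Matrix.diagonal_apply, smul_eq_mul]
  split_ifs with h
  · rw [sum_eq_single (hammingNorm x)]
    · rw [if_pos rfl, mul_one]
    · intro w _ hw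
      rw [if_neg (Ne.symm hw), mul_zero]
    · intro hx
      exact absurd (mem_range.2 (Nat.lt_succ_of_le (hammingNorm_le x))) hx
  · simp

open scoped MatrixOrder ComplexOrder in
theorem traceNorm_opF (n k : ℕ) : traceNorm (opF n k) = (detCost n (fEigenvalue n k) : ℝ) := by
  have hsqrt : CFC.sqrt (opF n k * (opF n k)ᴴ) =
      Matrix.diagonal fun x => ((|fEigenvalue n k (hammingNorm x)| : ℤ) : ℂ) := by
    refine CFC.sqrt_unique ?_ ?_
    · rw [opF_eq_diagonal, Matrix.diagonal_conjTranspose, Matrix.diagonal_mul_diagonal,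
        Matrix.diagonal_mul_diagonal]
      congr 1
      funext x
      rw [Pi.star_apply, ← Int.cast_mul, abs_mul_abs_self, Int.cast_mul]
      simp
    · refine Matrix.nonneg_iff_posSemidef.2 (Matrix.PosSemidef.diagonal fun x => ?_)
      have h := abs_nonneg (fEigenvalue n k (hammingNorm x))
      rw [Pi.zero_apply, ← Complex.ofReal_intCast]
      exact Complex.zero_le_real.2 (by exact_mod_cast h)
  have h := sum_comp_hammingNorm (Fin n) fun w => |fEigenvalue n k w|
  rw [Fintype.card_fin] at h
  rw [traceNorm, hsqrt, Matrix.trace_diagonal, detCost]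
  rw [← Int.cast_sum, h]
  simp

theorem fEigenvalue_zero_ne_zero {n k : ℕ} (hk : k ≤ n) (hk1 : 1 ≤ k) : fEigenvalue n k 0 ≠ 0 := by
  have h : (n : ℤ) - (((k + 1) / 2 : ℕ) : ℤ) - ((0 : ℕ) : ℤ) = ((n - (k + 1) / 2 : ℕ) : ℤ) := by
    omega
  rw [fEigenvalue, pow_zero, one_mul, h, Ring.choose_natCast]
  exact_mod_cast (Nat.choose_pos (by omega)).ne'

/-- If the eigenvalues of `F_{k+1}` are the cheapest nonzero relation, they determine the largest
design order. -/
theorem exists_tMax_eq {n k : ℕ} (hk2 : 2 ≤ k) (hk : k + 1 ≤ n)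
    (hmin : ∀ x, IsDetRelation n k x → (∃ w ≤ n, x w ≠ 0) →
      detCost n (fEigenvalue n (k + 1)) ≤ detCost n x) :
    ∃ T : ℕ, tMax n k = (T : ℕ∞) ∧ (T : ℝ) + 1 = 1 / 2 * traceNorm (opF n (k + 1)) := by
  have hf := isDetRelation_fEigenvalue hk
  have hf0 : ∃ w ≤ n, fEigenvalue n (k + 1) w ≠ 0 :=
    ⟨0, Nat.zero_le n, fEigenvalue_zero_ne_zero hk (by omega)⟩
  have hdeg := hf.two_mul_detDegree (by omega)
  -- the design condition for `t = 0` is trivial, so the degree is positive and `- 1` is exact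
  have hpos : 0 < detDegree n (fEigenvalue n (k + 1)) := by
    by_contra h0
    refine not_isDesign_of_detCost_le (t := 0) hk2 (by omega) hf hf0 (by omega) fun a b => ?_
    have := isProbabilityMeasure_uniformDistribution (isClosed_circuitGroup hk2 (by omega : k ≤ n))
    have := isProbabilityMeasure_uniformDistribution (isClosed_symmetricGroup n)
    simp [momentMatrix_apply]
  refine ⟨detDegree n (fEigenvalue n (k + 1)) - 1, le_antisymm ?_ ?_, ?_⟩
  · refine iSup₂_le fun t ht => ?_
    by_contra hlt
    rw [not_le, Nat.cast_lt] at hlt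
    exact not_isDesign_of_detCost_le hk2 (by omega) hf hf0 (by omega) ht
  · refine le_iSup₂ (f := fun (t : ℕ) (_ : IsDesign t (uniformDistribution (circuitGroup n k))
      (uniformDistribution (symmetricGroup n))) => (t : ℕ∞)) _
      (isDesign_of_lt_detCost hk2 (by omega) fun x hx hx0 => ?_)
    have := hmin x hx hx0
    omega
  · rw [traceNorm_opF, ← hdeg, Nat.cast_sub hpos]
    push_cast
    ring

theorem half_traceNorm_even {n p : ℕ} (hn : 2 * p + 1 ≤ n) :
    1 / 2 * traceNorm (opF n (p + p + 1)) =
      2 ^ (p + p) * Ring.choose (((n : ℝ) - 1) / 2) p := by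
  obtain ⟨M, rfl⟩ : ∃ M, n = M + 1 + p + p := ⟨n - (1 + p + p), by omega⟩
  rw [traceNorm_opF, detCost_fEigenvalue M p p (Or.inl rfl), shellSum_eq_shellCoeff, Int.cast_add,
    shellCoeff_eq_choose _ _ (by omega), ← two_mul p, pow_mul]
  norm_num
  ring

theorem half_traceNorm_odd {n r : ℕ} (hn : 2 * r + 2 ≤ n) :
    1 / 2 * traceNorm (opF n (r + 1 + r + 1)) =
      2 ^ (r + 1 + r) * Ring.choose ((n : ℝ) / 2) (r + 1) := by
  obtain ⟨M, rfl⟩ : ∃ M, n = M + 1 + (r + 1) + r := ⟨n - (1 + (r + 1) + r), by omega⟩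
  rw [traceNorm_opF, detCost_fEigenvalue M (r + 1) r (Or.inr rfl), shellSum_succ_add_eq_shellCoeff,
    shellCoeff_eq_choose _ _ (by omega)]
  have h : (((M + 1 + (r + 1) + r + 1 : ℕ) : ℝ) - 1) = ((M + 1 + (r + 1) + r : ℕ) : ℝ) := by
    push_cast
    ring
  rw [h, show (4 : ℝ) = 2 ^ 2 by norm_num, ← pow_mul, show 2 * (r + 1) = r + 1 + r + 1 by ring,
    pow_succ (2 : ℝ) (r + 1 + r)]
  ring

theorem tMax_even {n p : ℕ} (hp : 1 ≤ p) (hn : 2 ^ p * (p + 1) ≤ n) :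
    ∃ T : ℕ, tMax n (p + p) = (T : ℕ∞) ∧
      (T : ℝ) + 1 = 1 / 2 * traceNorm (opF n (p + p + 1)) := by
  have h2 : 2 ^ 1 * (p + 1) ≤ 2 ^ p * (p + 1) :=
    Nat.mul_le_mul_right _ (Nat.pow_le_pow_right (by norm_num) hp)
  exact exists_tMax_eq (by omega) (by omega) fun x hx hx0 =>
    detCost_fEigenvalue_le_even hp hn hx hx0

theorem tMax_odd {n r : ℕ} (hr : 1 ≤ r) (hn : 2 ^ r * (r + 2) ≤ n) :
    ∃ T : ℕ, tMax n (r + 1 + r) = (T : ℕ∞) ∧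
      (T : ℝ) + 1 = 1 / 2 * traceNorm (opF n (r + 1 + r + 1)) := by
  have h2 : 2 ^ 1 * (r + 2) ≤ 2 ^ r * (r + 2) :=
    Nat.mul_le_mul_right _ (Nat.pow_le_pow_right (by norm_num) hr)
  refine exists_tMax_eq (by omega) (by omega) fun x hx hx0 => ?_
  by_cases h6 : n = 6 ∧ r = 1
  · obtain ⟨rfl, rfl⟩ := h6
    exact detCost_fEigenvalue_le_six_three hx hx0
  · exact detCost_fEigenvalue_le_odd hr hn h6 hx hx0

end U1Circuits

theorem mainTheorem4 :
    (∀ n k : ℕ, 2 ≤ k → 2 ^ (k / 2) * ((k + 3) / 2) ≤ n →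
      ∃ T : ℕ, U1Circuits.tMax n k = (T : ℕ∞) ∧
        (T : ℝ) + 1 = 1 / 2 * U1Circuits.traceNorm (U1Circuits.opF n (k + 1)) ∧
        (Even k → 1 / 2 * U1Circuits.traceNorm (U1Circuits.opF n (k + 1)) =
          2 ^ k * Ring.choose (((n : ℝ) - 1) / 2) (k / 2)) ∧
        (Odd k → 1 / 2 * U1Circuits.traceNorm (U1Circuits.opF n (k + 1)) =
          2 ^ k * Ring.choose ((n : ℝ) / 2) ((k + 1) / 2))) ∧
    (∀ n : ℕ, 4 ≤ n → U1Circuits.tMax n 2 = ((2 * n - 3 : ℕ) : ℕ∞)) := by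
  refine ⟨fun n k hk hn => ?_, fun n hn => ?_⟩
  · obtain ⟨p, rfl⟩ | ⟨r, rfl⟩ := Nat.even_or_odd k
    · have hp : 1 ≤ p := by omega
      rw [show (p + p) / 2 = p by omega, show (p + p + 3) / 2 = p + 1 by omega] at hn
      have h2 : 2 ^ 1 * (p + 1) ≤ 2 ^ p * (p + 1) :=
        Nat.mul_le_mul_right _ (Nat.pow_le_pow_right (by norm_num) hp)
      obtain ⟨T, hT, hT1⟩ := U1Circuits.tMax_even hp hn
      refine ⟨T, hT, hT1, fun _ => ?_, fun h => absurd ⟨p, rfl⟩ (Nat.not_even_iff_odd.2 h)⟩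
      rw [U1Circuits.half_traceNorm_even (by omega), show (p + p) / 2 = p by omega]
    · have hr : 1 ≤ r := by omega
      rw [show (2 * r + 1) / 2 = r by omega, show (2 * r + 1 + 3) / 2 = r + 2 by omega] at hn
      have h2 : 2 ^ 1 * (r + 2) ≤ 2 ^ r * (r + 2) :=
        Nat.mul_le_mul_right _ (Nat.pow_le_pow_right (by norm_num) hr)
      rw [show 2 * r + 1 = r + 1 + r by ring]
      obtain ⟨T, hT, hT1⟩ := U1Circuits.tMax_odd hr hn
      refine ⟨T, hT, hT1, fun h => absurd h (Nat.not_even_iff_odd.2 ⟨r, by ring⟩), fun _ => ?_⟩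
      rw [U1Circuits.half_traceNorm_odd (by omega), show (r + 1 + r + 1) / 2 = r + 1 by omega]
  · obtain ⟨T, hT, hT1⟩ := U1Circuits.tMax_even (n := n) (p := 1) le_rfl (by omega)
    rw [U1Circuits.half_traceNorm_even (by omega), Ring.choose_one_right] at hT1
    have h : T + 3 = 2 * n := by
      have : (T : ℝ) + 3 = 2 * n := by linear_combination hT1
      exact_mod_cast this
    rw [hT, show T = 2 * n - 3 by omega]
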